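/- Let $\Bbbk$ be an algebraically closed field of characteristic $0$, $\Gamma$ a commutative domain that is finitely generated as a $\Bbbk$-algebra, $K$ its field of fractions, $L/K$ a finite Galois extension with group $G$, and $\mathcal M\subset \mathrm{Aut}_{\Bbbk}(L)$ a submonoid that is closed under conjugation by $G$ and separating (if $m_1,m_2\in\mathcal M$ and $m_1|_K=m_2|_K$, then $m_1=m_2$). Let $\mathcal K=(L*\mathcal M)^G$ be the ring of $G$-invariants in the skew monoid ring $L*\mathcal M$. A Galois ring over $\Gamma$ is a subring $U\subset\mathcal K$ that is generated by $\Gamma$ and finitely many elements and satisfies $KU=UK=\mathcal K$. It is a right (left) Galois order if $W\cap U$ is a finitely generated right (left) $\Gamma$-module for every finite-dimensional right (left) $K$-subspace $W\subset\mathcal K$, and a Galois order if it is both. Let $U$ be a Galois ring over $\Gamma$ and $\mathfrak m\in\mathrm{Specm}\,\Gamma$. Let $\bar\Gamma$ be the integral closure of $\Gamma$ in $L$. For a maximal ideal $\ell$ of $\bar\Gamma$ and $m\in\mathcal M$ put $m\cdot\ell=\{x\in\bar\Gamma : m^{-1}(x)\in\ell\}$. Suppose that for every maximal ideal $\ell$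 of $\bar\Gamma$ lying over $\mathfrak m$ the stabilizer $\{m\in\mathcal M : m\cdot\ell=\ell\}$ is finite. Let the fiber $\Phi(\mathfrak m)$ be the set of maximal left ideals $I$ of $U$ containing $\mathfrak m$, where $I$ and $J$ are identified if $U/I\cong U/J$ as left $U$-modules. A Gelfand–Tsetlin module is a finitely generated left $U$-module $V$ such that $V=\bigoplus_{\mathfrak n\in\mathrm{Specm}\,\Gamma}V(\mathfrak n)$, where $V(\mathfrak n)=\{v\in V : \mathfrak n^k v=0 \text{ for some } k\ge 0\}$. 1. If $U$ is a right Galois order over $\Gamma$, then $\Phi(\mathfrak m)$ is non-empty, $U\mathfrak m\ne U$, and there is a maximal left ideal $I\supset\mathfrak m$ of $U$ such that $V=U/I$ is a simple Gelfand–Tsetlin module with $V(\mathfrak m)\ne 0$. 2. If $U$ is a Galois order over $\Gamma$, then $\Phi(\mathfrak m)$ is finite. -/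

import Mathlib

namespace GaloisOrder

/-! ### Spans over a subring, on the left and on the right -/

section Spans

variable {R : Type*} [Ring R]

/-- The left `A`-submodule of the ring `R` generated by `s`, where `A` is a subring of `R`. -/
def leftSpan (A : Subring R) (s : Set R) : AddSubgroup R :=
  AddSubgroup.closure {x | ∃ a ∈ A, ∃ y ∈ s, x = a * y}

/-- The right `A`-submodule of the ring `R` generated by `s`, where `A` is a subring of `R`. -/
def rightSpan (A : Subring R) (s : Set R) : AddSubgroup R :=
  AddSubgroup.closure {x | ∃ y ∈ s, ∃ a ∈ A, x = y * a}

end Spans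

/-! ### The skew monoid ring and its invariants -/

section Skew

variable {k L : Type*} (K : Type*) [Field k] [Field K] [Field L]
  [Algebra k K] [Algebra k L] [Algebra K L] [IsScalarTower k K L]

/-- The conjugate `g μ g⁻¹` of an automorphism `μ` of `L` by `g` in the Galois group of `L/K`. -/
def conjAut {K : Type*} [Field K] [Algebra k K] [Algebra K L] [IsScalarTower k K L]
    (g : L ≃ₐ[K] L) (μ : L ≃ₐ[k] L) : L ≃ₐ[k] L :=
  g.restrictScalars k * μ * (g.restrictScalars k)⁻¹

/-- The monoid `M` is closed under conjugation by the Galois group of `L/K`. -/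
def IsConjClosed (M : Submonoid (L ≃ₐ[k] L)) : Prop :=
  ∀ g : L ≃ₐ[K] L, ∀ μ ∈ M, conjAut g μ ∈ M

/-- The monoid `M` is separating with respect to `K`: its elements are determined by their
restrictions to `K`. -/
def IsSeparating (M : Submonoid (L ≃ₐ[k] L)) : Prop :=
  ∀ μ ∈ M, ∀ ν ∈ M, (∀ a : K, μ (algebraMap K L a) = ν (algebraMap K L a)) → μ = ν

variable {K} {M : Submonoid (L ≃ₐ[k] L)}

/-- The action of `g` in the Galois group on the skew monoid ring `L * M`, sending `l μ` to
`g(l) (g μ g⁻¹)`. -/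
noncomputable def galAct (hM : IsConjClosed K M) (g : L ≃ₐ[K] L) :
    SkewMonoidAlgebra L M →+ SkewMonoidAlgebra L M :=
  SkewMonoidAlgebra.liftNC
    ((SkewMonoidAlgebra.singleAddHom (1 : M)).comp (g : L →+ L))
    (fun μ : M => SkewMonoidAlgebra.single (⟨conjAut g μ, hM g μ μ.2⟩ : M) (1 : L))

theorem galAct_single (hM : IsConjClosed K M) (g : L ≃ₐ[K] L) (μ : M) (l : L) :
    galAct hM g (SkewMonoidAlgebra.single μ l) =
      SkewMonoidAlgebra.single (⟨conjAut g μ, hM g μ μ.2⟩ : M) (g l) := by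
  simp [galAct, SkewMonoidAlgebra.single_mul_single]

theorem galAct_one (hM : IsConjClosed K M) (g : L ≃ₐ[K] L) : galAct hM g 1 = 1 := by
  rw [SkewMonoidAlgebra.one_def, galAct_single]
  congr 1
  · ext1
    simp [conjAut]
  · simp

theorem galAct_mul (hM : IsConjClosed K M) (g : L ≃ₐ[K] L) (x y : SkewMonoidAlgebra L M) :
    galAct hM g (x * y) = galAct hM g x * galAct hM g y := by
  induction x using SkewMonoidAlgebra.induction_on with
  | zero => simp
  | add x₁ x₂ h₁ h₂ => simp [add_mul, h₁, h₂]
  | single μ a =>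
    induction y using SkewMonoidAlgebra.induction_on with
    | zero => simp
    | add y₁ y₂ h₁ h₂ => simp [mul_add, h₁, h₂]
    | single ν b =>
      simp only [SkewMonoidAlgebra.single_mul_single, galAct_single]
      congr 1
      · ext1
        simp [conjAut, mul_assoc]
      · rw [map_mul]
        congr 1
        change g ((μ : L ≃ₐ[k] L) b) = (conjAut g (μ : L ≃ₐ[k] L)) (g b)
        simp [conjAut, AlgEquiv.aut_inv]

/-- The ring `(L * M)^G` of invariants of the Galois group in the skew monoid ring. -/
noncomputable def invariants (hM : IsConjClosed K M) : Subring (SkewMonoidAlgebra L M) where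
  carrier := {x | ∀ g : L ≃ₐ[K] L, galAct hM g x = x}
  mul_mem' hx hy g := by rw [galAct_mul, hx g, hy g]
  one_mem' g := galAct_one hM g
  add_mem' hx hy g := by rw [map_add, hx g, hy g]
  zero_mem' g := map_zero _
  neg_mem' hx g := by rw [map_neg, hx g]

/-- The embedding of a coefficient ring `A` (with an algebra `L` over it) into `L * M`. -/
noncomputable def coeffHom (A : Type*) [CommRing A] [Algebra A L] (M : Submonoid (L ≃ₐ[k] L)) :
    A →+* SkewMonoidAlgebra L M :=
  (SkewMonoidAlgebra.singleOneRingHom (k := L) (G := M)).comp (algebraMap A L)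

/-- The image of `A` in `L * M`. -/
noncomputable def coeffRing (A : Type*) [CommRing A] [Algebra A L] (M : Submonoid (L ≃ₐ[k] L)) :
    Subring (SkewMonoidAlgebra L M) :=
  (coeffHom A M).range

/-! ### Galois rings and Galois orders -/

/-- `U` is a Galois ring over `Γ`: a subring of the invariants which is generated by `Γ` and
finitely many further elements, with `K U = U K` equal to the whole ring of invariants. -/
structure IsGaloisRing (Γ : Type*) [CommRing Γ] [Algebra Γ L] (hM : IsConjClosed K M)
    (U : Subring (SkewMonoidAlgebra L M)) : Prop where
  le_invariants : U ≤ invariants hM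
  fg : ∃ s : Finset (SkewMonoidAlgebra L M),
    Subring.closure ((coeffRing Γ M : Set (SkewMonoidAlgebra L M)) ∪ s) = U
  left_span : leftSpan (coeffRing K M) U = (invariants hM).toAddSubgroup
  right_span : rightSpan (coeffRing K M) U = (invariants hM).toAddSubgroup

/-- For every finite-dimensional right `K`-subspace `W` of the invariants, `W ∩ U` is a finitely
generated right `Γ`-module. -/
def IsRightOrder (Γ : Type*) [CommRing Γ] [Algebra Γ L] (hM : IsConjClosed K M)
    (U : Subring (SkewMonoidAlgebra L M)) : Prop :=
  ∀ s : Finset (SkewMonoidAlgebra L M), (s : Set (SkewMonoidAlgebra L M)) ⊆ invariants hM →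
    ∃ t : Finset (SkewMonoidAlgebra L M),
      rightSpan (coeffRing K M) (s : Set (SkewMonoidAlgebra L M)) ⊓ U.toAddSubgroup =
        rightSpan (coeffRing Γ M) (t : Set (SkewMonoidAlgebra L M))

/-- For every finite-dimensional left `K`-subspace `W` of the invariants, `W ∩ U` is a finitely
generated left `Γ`-module. -/
def IsLeftOrder (Γ : Type*) [CommRing Γ] [Algebra Γ L] (hM : IsConjClosed K M)
    (U : Subring (SkewMonoidAlgebra L M)) : Prop :=
  ∀ s : Finset (SkewMonoidAlgebra L M), (s : Set (SkewMonoidAlgebra L M)) ⊆ invariants hM →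
    ∃ t : Finset (SkewMonoidAlgebra L M),
      leftSpan (coeffRing K M) (s : Set (SkewMonoidAlgebra L M)) ⊓ U.toAddSubgroup =
        leftSpan (coeffRing Γ M) (t : Set (SkewMonoidAlgebra L M))

/-- The inclusion of `Γ` into a Galois ring over `Γ`. -/
noncomputable def IsGaloisRing.incl {Γ : Type*} [CommRing Γ] [Algebra Γ L]
    {hM : IsConjClosed K M} {U : Subring (SkewMonoidAlgebra L M)} (hU : IsGaloisRing Γ hM U) :
    Γ →+* U :=
  (coeffHom Γ M).codRestrict U fun γ => by
    obtain ⟨s, hs⟩ := hU.fg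
    rw [← hs]
    exact Subring.subset_closure (Or.inl ⟨γ, rfl⟩)

/-! ### Stabilizers of maximal ideals -/

/-- The translate of an ideal `ℓ` of the integral closure of `Γ` in `L` by `μ`: the elements `x`
of the integral closure with `μ⁻¹(x) ∈ ℓ`. It equals the image `μ(ℓ)` if `μ` preserves the
integral closure. If only `μ⁻¹` maps the integral closure into itself, it is the preimage of `ℓ`
under that endomorphism, that is, the image of the point `ℓ` under the induced map of maximal
spectra. -/
def translate {Γ : Type*} [CommRing Γ] [Algebra Γ L] (μ : L ≃ₐ[k] L)
    (ℓ : Ideal (integralClosure Γ L)) : Set (integralClosure Γ L) :=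
  {x | ∃ y ∈ ℓ, (y : L) = μ.symm (x : L)}

/-- The stabilizer of `ℓ` in `M`. -/
def stabilizer {Γ : Type*} [CommRing Γ] [Algebra Γ L] (M : Submonoid (L ≃ₐ[k] L))
    (ℓ : Ideal (integralClosure Γ L)) : Set (L ≃ₐ[k] L) :=
  {μ | μ ∈ M ∧ translate μ ℓ = (ℓ : Set (integralClosure Γ L))}

end Skew

/-! ### Gelfand-Tsetlin modules and fibers -/

section Modules

variable {Γ A : Type*} [CommRing Γ] [Ring A] (φ : Γ →+* A)

/-- The generalized weight space `V(𝔪)`: the vectors killed by some power of `𝔪`, where `Γ` acts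
through `φ`. -/
def weightSpace (V : Type*) [AddCommGroup V] [Module A V] (𝔪 : Ideal Γ) : AddSubgroup V where
  carrier := {v | ∃ n : ℕ, ∀ γ ∈ 𝔪 ^ n, φ γ • v = 0}
  zero_mem' := ⟨0, by simp⟩
  add_mem' := by
    rintro v w ⟨m, hm⟩ ⟨n, hn⟩
    refine ⟨max m n, fun γ hγ => ?_⟩
    rw [smul_add, hm γ (Ideal.pow_le_pow_right (le_max_left m n) hγ),
      hn γ (Ideal.pow_le_pow_right (le_max_right m n) hγ), add_zero]
  neg_mem' := by
    rintro v ⟨n, hn⟩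
    exact ⟨n, fun γ hγ => by rw [smul_neg, hn γ hγ, neg_zero]⟩

open Classical in
/-- A Gelfand-Tsetlin module: a finitely generated module which is the direct sum of its
generalized weight spaces with respect to `Γ`. -/
def IsGelfandTsetlin (V : Type*) [AddCommGroup V] [Module A V] : Prop :=
  Module.Finite A V ∧
    DirectSum.IsInternal fun 𝔪 : MaximalSpectrum Γ => weightSpace φ V 𝔪.asIdeal

/-- The left ideal `A 𝔪` of `A` generated by `𝔪`. -/
def leftIdealGen (𝔪 : Ideal Γ) : Submodule A A :=
  Submodule.span A (φ '' (𝔪 : Set Γ))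

/-- The maximal left ideals of `A` that contain `𝔪`. -/
def MaxLeftIdealOver (𝔪 : Ideal Γ) : Type _ :=
  {I : Submodule A A // IsCoatom I ∧ ∀ γ ∈ 𝔪, φ γ ∈ I}

/-- Two maximal left ideals are identified if the simple modules that they define are
isomorphic. -/
def fiberSetoid (𝔪 : Ideal Γ) : Setoid (MaxLeftIdealOver φ 𝔪) where
  r I J := Nonempty ((A ⧸ I.1) ≃ₗ[A] (A ⧸ J.1))
  iseqv :=
    { refl := fun I => ⟨LinearEquiv.refl A (A ⧸ I.1)⟩
      symm := fun ⟨e⟩ => ⟨e.symm⟩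
      trans := fun ⟨e⟩ ⟨f⟩ => ⟨e.trans f⟩ }

/-- The fiber over `𝔪`: the maximal left ideals `I` of `A` that contain `𝔪`, up to isomorphism of
the simple modules `A ⧸ I`. -/
def Fiber (𝔪 : Ideal Γ) : Type _ :=
  Quotient (fiberSetoid φ 𝔪)

end Modules

end GaloisOrder

/-!
The functions `t ↦ ∑ xᵢ t(yᵢ)` on `M` with `xᵢ, yᵢ ∈ Γ` act on `U` by multiplication of the
coefficients, because `x u y` has the coefficients `x t(y) u_t`. Prime ideals of a ring of such
functions correspond to pairs `(t • ℓ, ℓ)` of points of the spectrum of the integral closure, so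
localization at a pair of points over `𝔪` only retains the coefficients at those `t` that move a
point over `𝔪` to a point over `𝔪`. The finite stabilizers leave finitely many such `t` with
`t⁻¹ ∈ M`, and by the right order condition the right coefficients of the elements of `U` that are
supported there generate a finite `Γ`-module.

If `U 𝔪 = U`, then `1 ∈ U 𝔪ⁿ` for all `n`, and Krull's intersection theorem in this finite module
gives a contradiction at the coefficient of `1`.

An element of `U` without invertible elements in its support lies in every maximal left ideal
`I ⊇ 𝔪`. Otherwise some `x = y z` with `z` of this kind acts as the identity on `1 + I`, and so do
the products of any length of copies of `x` interlaced with elements of `Γ`, up to the residues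
of these elements at `𝔪`. Their expansion yields a word `t₁ ⋯ tⱼ` in the support of `x` and a point
`ℓ` all of whose images under `tᵢ ⋯ tⱼ` lie over `𝔪`. The pigeonhole principle shows that a
subword fixes a point, so it has finite order and its first letter is invertible in `M`.

So, modulo `I`, the elements of `U` that map `1 + I` to its multiples in `U / I` are represented by
the finite module above, whose image modulo `U 𝔪` is a finite-dimensional space that does not
depend on `I`. By the density theorem there are then finitely many classes of such `I`.
-/

namespace GaloisOrder

open SkewMonoidAlgebra

section PairFunctions

variable {k L : Type*} [Field k] [Field L] [Algebra k L] {M : Submonoid (L ≃ₐ[k] L)}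

/-- The function `t ↦ x t(y)` on `M`. Multiplying the coefficient at `t` by it, for every `t`, is
the two-sided multiplication `w ↦ x w y` of the skew monoid ring `L * M`. -/
def pairFun (M : Submonoid (L ≃ₐ[k] L)) (x y : L) : M → L := fun t => x * (t : L ≃ₐ[k] L) y

theorem pairFun_apply (x y : L) (t : M) : pairFun M x y t = x * (t : L ≃ₐ[k] L) y := rfl

theorem pairFun_mul_pairFun (x y x' y' : L) :
    pairFun M x y * pairFun M x' y' = pairFun M (x * x') (y * y') := by
  funext t
  simp only [Pi.mul_apply, pairFun_apply, map_mul, mul_mul_mul_comm]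

theorem pairFun_one_one : pairFun M (1 : L) 1 = 1 := by
  funext t
  simp only [pairFun_apply, map_one, mul_one, Pi.one_apply]

/-- The functions `x t(y)` with `x, y ∈ C`. -/
def pairMonoid (M : Submonoid (L ≃ₐ[k] L)) (C : Subring L) : Submonoid (M → L) where
  carrier := {a | ∃ x ∈ C, ∃ y ∈ C, pairFun M x y = a}
  one_mem' := ⟨1, C.one_mem, 1, C.one_mem, pairFun_one_one⟩
  mul_mem' := by
    rintro _ _ ⟨x, hx, y, hy, rfl⟩ ⟨x', hx', y', hy', rfl⟩
    exact ⟨_, C.mul_mem hx hx', _, C.mul_mem hy hy', (pairFun_mul_pairFun x y x' y').symm⟩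

/-- The ring of the functions `t ↦ ∑ xᵢ t(yᵢ)` on `M` with `xᵢ, yᵢ ∈ C`: the image of `C ⊗ C`, which
acts on the `C`-bimodule `L * M`. -/
def pairRing (M : Submonoid (L ≃ₐ[k] L)) (C : Subring L) : Subring (M → L) :=
  Subring.closure (pairMonoid M C)

theorem pairFun_mem_pairRing {C : Subring L} {x y : L} (hx : x ∈ C) (hy : y ∈ C) :
    pairFun M x y ∈ pairRing M C :=
  Subring.subset_closure ⟨x, hx, y, hy, rfl⟩

theorem pairRing_le {C : Subring L} {S : AddSubgroup (M → L)}
    (h : ∀ x ∈ C, ∀ y ∈ C, pairFun M x y ∈ S) : (pairRing M C).toAddSubgroup ≤ S := by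
  intro a ha
  rw [Subring.mem_toAddSubgroup, pairRing, Subring.mem_closure_iff, Submonoid.closure_eq] at ha
  refine (AddSubgroup.closure_le S).2 ?_ ha
  rintro _ ⟨x, hx, y, hy, rfl⟩
  exact h x hx y hy

theorem pairRing_mono {C C' : Subring L} (h : C ≤ C') : pairRing M C ≤ pairRing M C' :=
  pairRing_le (S := (pairRing M C').toAddSubgroup) fun _ hx _ hy =>
    pairFun_mem_pairRing (h hx) (h hy)

theorem pairFun_mul_mem_pairRing {C D : Subring L} {d : L} (hd : ∀ x ∈ C, d * x ∈ D) {a : M → L}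
    (ha : a ∈ pairRing M C) : pairFun M d d * a ∈ pairRing M D := by
  refine pairRing_le
    (S := (pairRing M D).toAddSubgroup.comap (AddMonoidHom.mulLeft (pairFun M d d))) ?_ ha
  intro x hx y hy
  rw [AddSubgroup.mem_comap, AddMonoidHom.coe_mulLeft, pairFun_mul_pairFun]
  exact pairFun_mem_pairRing (hd x hx) (hd y hy)

theorem apply_one_mem_of_mem_pairRing {C : Subring L} {a : M → L} (ha : a ∈ pairRing M C) :
    a 1 ∈ C :=
  pairRing_le (S := C.toAddSubgroup.comap (Pi.evalAddMonoidHom (fun _ : M => L) 1))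
    (fun _ hx _ hy => C.mul_mem hx hy) ha

/-- The constant functions with values in `C`. -/
def leftPair (M : Submonoid (L ≃ₐ[k] L)) (C : Subring L) : C →+* pairRing M C where
  toFun x := ⟨pairFun M x 1, pairFun_mem_pairRing x.2 C.one_mem⟩
  map_one' := Subtype.ext pairFun_one_one
  map_mul' x y := by ext t; simp [pairFun_apply]
  map_zero' := by ext t; simp [pairFun_apply]
  map_add' x y := by ext t; simp [pairFun_apply]

/-- The functions `t ↦ t(y)` with `y ∈ C`. -/
def rightPair (M : Submonoid (L ≃ₐ[k] L)) (C : Subring L) : C →+* pairRing M C where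
  toFun y := ⟨pairFun M 1 y, pairFun_mem_pairRing C.one_mem y.2⟩
  map_one' := Subtype.ext pairFun_one_one
  map_mul' x y := by ext t; simp [pairFun_apply]
  map_zero' := by ext t; simp [pairFun_apply]
  map_add' x y := by ext t; simp [pairFun_apply]

theorem leftPair_apply {C : Subring L} (x : C) (t : M) : (leftPair M C x : M → L) t = x := by
  simp [leftPair, pairFun_apply]

theorem rightPair_apply {C : Subring L} (y : C) (t : M) :
    (rightPair M C y : M → L) t = (t : L ≃ₐ[k] L) y := by
  simp [rightPair, pairFun_apply]

theorem inclusion_leftPair {C D : Subring L} (h : D ≤ C) (x : D) :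
    Subring.inclusion (pairRing_mono h) (leftPair M D x) = leftPair M C (Subring.inclusion h x) :=
  Subtype.ext <| funext fun t => by
    rw [Subring.coe_inclusion, leftPair_apply, leftPair_apply, Subring.coe_inclusion]

theorem inclusion_rightPair {C D : Subring L} (h : D ≤ C) (y : D) :
    Subring.inclusion (pairRing_mono h) (rightPair M D y) = rightPair M C (Subring.inclusion h y) :=
  Subtype.ext <| funext fun t => by
    rw [Subring.coe_inclusion, rightPair_apply, rightPair_apply, Subring.coe_inclusion]

/-- The ideal of the functions in `pairRing M C` that vanish on `T`. -/
def vanishIdeal (C : Subring L) (T : Set M) : Ideal (pairRing M C) where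
  carrier := {a | ∀ t ∈ T, (a : M → L) t = 0}
  zero_mem' _ _ := rfl
  add_mem' ha hb t ht := (congrArg₂ (· + ·) (ha t ht) (hb t ht)).trans (add_zero 0)
  smul_mem' c _ ha t ht := mul_eq_zero_of_right ((c : M → L) t) (ha t ht)

/-- The evaluation of the functions in `pairRing M C` at the identity. -/
def evalOne (M : Submonoid (L ≃ₐ[k] L)) (C : Subring L) : pairRing M C →+* C :=
  ((Pi.evalRingHom (fun _ : M => L) 1).comp (pairRing M C).subtype).codRestrict C
    fun a => apply_one_mem_of_mem_pairRing a.2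

theorem evalOne_leftPair {C : Subring L} (x : C) : evalOne M C (leftPair M C x) = x :=
  Subtype.ext (leftPair_apply x 1)

theorem evalOne_rightPair {C : Subring L} (y : C) : evalOne M C (rightPair M C y) = y :=
  Subtype.ext (rightPair_apply y 1)

theorem isIntegral_inclusion_pairRing {D C : Subring L} (h : D ≤ C)
    (hint : (Subring.inclusion h).IsIntegral) :
    (Subring.inclusion (pairRing_mono (M := M) h)).IsIntegral := by
  let i := Subring.inclusion (pairRing_mono (M := M) h)
  have hcomp {j : D →+* pairRing M D} {j' : C →+* pairRing M C}
      (hj : i.comp j = j'.comp (Subring.inclusion h)) (x : C) : i.IsIntegralElem (j' x) := by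
    obtain ⟨p, hp, hx⟩ := hint x
    refine ⟨p.map j, hp.map j, ?_⟩
    rw [Polynomial.eval₂_map, hj, ← Polynomial.hom_eval₂, hx, map_zero]
  let S : AddSubgroup (pairRing M C) :=
    { carrier := {a | i.IsIntegralElem a}
      zero_mem' := i.isIntegralElem_zero
      add_mem' := fun ha hb => ha.add i hb
      neg_mem' := fun ha => ha.neg i }
  rintro ⟨a, ha⟩
  have hle : (pairRing M C).toAddSubgroup ≤ S.map (pairRing M C).subtype.toAddMonoidHom := by
    refine pairRing_le fun x hx y hy => ⟨leftPair M C ⟨x, hx⟩ * rightPair M C ⟨y, hy⟩, ?_, ?_⟩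
    · exact (hcomp (j := leftPair M D) rfl _).mul i (hcomp (j := rightPair M D) rfl _)
    · funext t
      exact congrArg₂ (· * ·) (leftPair_apply _ t) (rightPair_apply _ t)
  obtain ⟨b, hb, rfl⟩ := hle ha
  exact hb

/-- Multiplication of the coefficients of elements of `L * M` by the values of a function `a` on
`M`, as an additive map. -/
noncomputable def scaleAddHom (a : M → L) : SkewMonoidAlgebra L M →+ SkewMonoidAlgebra L M where
  toFun w := ⟨Finsupp.onFinset w.support (fun t => a t * w.coeff t) fun t ht =>
    mem_support_iff.2 (right_ne_zero_of_mul ht)⟩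
  map_zero' := by ext; simp
  map_add' v w := by ext; simp [mul_add]

/-- The action of the ring of functions on `M` on `L * M` by multiplication of the coefficients. -/
noncomputable def scale : (M → L) →+* AddMonoid.End (SkewMonoidAlgebra L M) where
  toFun := scaleAddHom
  map_one' := by ext w t; exact one_mul (w.coeff t)
  map_mul' a b := by ext w t; exact mul_assoc (a t) (b t) (w.coeff t)
  map_zero' := by ext w t; exact zero_mul (w.coeff t)
  map_add' a b := by
    ext w t
    change (a t + b t) * w.coeff t = (scaleAddHom a w + scaleAddHom b w).coeff t
    rw [add_mul, coeff_add]
    rfl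

@[simp]
theorem coeff_scale (a : M → L) (w : SkewMonoidAlgebra L M) (t : M) :
    (scale a w).coeff t = a t * w.coeff t := rfl

theorem scale_mul_apply (a b : M → L) (w : SkewMonoidAlgebra L M) :
    scale (a * b) w = scale a (scale b w) :=
  DFunLike.congr_fun (map_mul scale a b) w

theorem coeff_mul_single_one_eq (w : SkewMonoidAlgebra L M) (y : L) (t : M) :
    (w * single 1 y).coeff t = w.coeff t * (t : L ≃ₐ[k] L) y :=
  coeff_mul_single_one w y t

theorem scale_pairFun (x y : L) (w : SkewMonoidAlgebra L M) :
    scale (pairFun M x y) w = single 1 x * w * single 1 y := by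
  ext t
  rw [coeff_scale, coeff_mul_single_one_eq, coeff_single_one_mul, pairFun_apply, mul_right_comm]

theorem scale_mul_single_one (a : M → L) (y : L) (w : SkewMonoidAlgebra L M) :
    scale a (w * single 1 y) = scale a w * single 1 y := by
  ext t
  rw [coeff_scale, coeff_mul_single_one_eq, coeff_mul_single_one_eq, coeff_scale, mul_assoc]

theorem scale_mem {C : Subring L} {U : AddSubgroup (SkewMonoidAlgebra L M)}
    {w : SkewMonoidAlgebra L M} (h : ∀ x ∈ C, ∀ y ∈ C, single 1 x * w * single 1 y ∈ U)
    {a : M → L} (ha : a ∈ pairRing M C) : scale a w ∈ U := by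
  refine pairRing_le
    (S := U.comap ((AddMonoidHom.eval w).comp scale.toAddMonoidHom)) (fun x hx y hy => ?_) ha
  change scale (pairFun M x y) w ∈ U
  rw [scale_pairFun]
  exact h x hx y hy

/-- The coefficients of `w` when they are written on the right. It turns right multiplication by
elements of `L` into the multiplication of functions by scalars. -/
noncomputable def rightCoeff : SkewMonoidAlgebra L M →+ (M → L) where
  toFun w t := (t : L ≃ₐ[k] L).symm (w.coeff t)
  map_zero' := by funext; simp
  map_add' v w := by funext; simp

theorem rightCoeff_apply (w : SkewMonoidAlgebra L M) (t : M) :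
    rightCoeff w t = (t : L ≃ₐ[k] L).symm (w.coeff t) := rfl

theorem rightCoeff_injective :
    Function.Injective (rightCoeff : SkewMonoidAlgebra L M →+ (M → L)) := by
  intro v w h
  ext t
  exact (t : L ≃ₐ[k] L).symm.injective (congrFun h t)

theorem rightCoeff_mul_single_one (w : SkewMonoidAlgebra L M) (y : L) :
    rightCoeff (w * single 1 y) = y • rightCoeff w := by
  funext t
  simp [rightCoeff_apply, coeff_mul_single_one_eq, mul_comm]

end PairFunctions

section MonoidActions

variable {A X : Type*} [Group A] {E M : Submonoid A} [MulAction E X]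

theorem left_inv_mem_of_mul {a b : A} (hb : b ∈ M) (h : (a * b)⁻¹ ∈ M) : a⁻¹ ∈ M := by
  have hab : a⁻¹ = b * (a * b)⁻¹ := by group
  exact hab ▸ M.mul_mem hb h

theorem right_inv_mem_of_mul {a b : A} (ha : a ∈ M) (h : (a * b)⁻¹ ∈ M) : b⁻¹ ∈ M := by
  have hab : b⁻¹ = (a * b)⁻¹ * a := by group
  exact hab ▸ M.mul_mem h ha

theorem inv_mem_of_isOfFinOrder {a : A} (ha : a ∈ M) (hord : IsOfFinOrder a) : a⁻¹ ∈ M := by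
  have hpow : a⁻¹ ∈ Submonoid.powers a :=
    hord.mem_powers_iff_mem_zpowers.2 (inv_mem (Subgroup.mem_zpowers a))
  exact Submonoid.powers_le.2 ha hpow

/-- The stabilizer of `y` in a submonoid `M` of the monoid `E` acting on `X`. -/
def stabilizerIn (hME : M ≤ E) (y : X) : Submonoid M :=
  (MulAction.stabilizerSubmonoid E y).comap (Submonoid.inclusion hME)

theorem mem_stabilizerIn {hME : M ≤ E} {y : X} {a : M} :
    a ∈ stabilizerIn hME y ↔ Submonoid.inclusion hME a • y = y := Iff.rfl

theorem inv_mem_of_mem_finite {S : Submonoid M} (hfin : (S : Set M).Finite) {a : M} (ha : a ∈ S) :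
    (a : A)⁻¹ ∈ M := by
  have hpowers : (Submonoid.powers a : Set M).Finite := hfin.subset (Submonoid.powers_le.2 ha)
  have himage := hpowers.image M.subtype
  rw [← Submonoid.coe_map, Submonoid.map_powers] at himage
  exact inv_mem_of_isOfFinOrder a.2 (finite_powers.1 himage)

theorem exists_mul_pow_eq {m g : A} (hm : m ∈ M) (hnorm : ∀ a ∈ M, g * a * g⁻¹ ∈ M) (n : ℕ) :
    ∃ q ∈ M, (m * g) ^ (n + 1) = m * q * g ^ (n + 1) := by
  induction n with
  | zero => exact ⟨1, M.one_mem, by simp⟩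
  | succ n ih =>
    obtain ⟨q, hq, h⟩ := ih
    refine ⟨g * (m * q) * g⁻¹, hnorm _ (M.mul_mem hm hq), ?_⟩
    rw [pow_succ', h, pow_succ' g (n + 1)]
    group

theorem inv_mem_of_mul_smul_eq {hME : M ≤ E} {m : M} {g : E} {y : X} {n : ℕ}
    (hnorm : ∀ a ∈ M, (g : A) * a * (g : A)⁻¹ ∈ M) (hn : n ≠ 0) (hgn : g ^ n = 1)
    (hy : (Submonoid.inclusion hME m * g) • y = y)
    (hfin : (stabilizerIn hME y : Set M).Finite) : (m : A)⁻¹ ∈ M := by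
  obtain ⟨n, rfl⟩ := Nat.exists_eq_succ_of_ne_zero hn
  obtain ⟨q, hq, hpow⟩ := exists_mul_pow_eq m.2 hnorm n
  have hmq : Submonoid.inclusion hME (m * ⟨q, hq⟩) = (Submonoid.inclusion hME m * g) ^ (n + 1) := by
    have hgn' : (g : A) ^ (n + 1) = 1 := by rw [← SubmonoidClass.coe_pow, hgn, Submonoid.coe_one]
    refine Subtype.ext ?_
    rw [SubmonoidClass.coe_pow, Submonoid.coe_mul, Submonoid.coe_inclusion, Submonoid.coe_inclusion,
      hpow, hgn', mul_one, Submonoid.coe_mul]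
  have hmem : m * ⟨q, hq⟩ ∈ stabilizerIn hME y := by
    rw [mem_stabilizerIn, hmq]
    exact pow_mem (show _ ∈ MulAction.stabilizerSubmonoid E y from hy) (n + 1)
  exact left_inv_mem_of_mul hq (inv_mem_of_mem_finite hfin hmem)

theorem finite_setOf_inv_mem_and_smul_eq {hME : M ≤ E} {y z : X}
    (hfin : (stabilizerIn hME y : Set M).Finite) :
    {a : M | (a : A)⁻¹ ∈ M ∧ Submonoid.inclusion hME a • y = z}.Finite := by
  rcases Set.eq_empty_or_nonempty {a : M | (a : A)⁻¹ ∈ M ∧ Submonoid.inclusion hME a • y = z} with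
    h | ⟨b, hb, hbz⟩
  · rw [h]
    exact Set.finite_empty
  · refine (hfin.image (b * ·)).subset ?_
    rintro a ⟨-, haz⟩
    refine ⟨⟨_, hb⟩ * a, ?_, by ext; simp⟩
    have hinv : Submonoid.inclusion hME ⟨_, hb⟩ * Submonoid.inclusion hME b = 1 := by ext; simp
    change Submonoid.inclusion hME (⟨_, hb⟩ * a) • y = y
    rw [map_mul, mul_smul, haz, ← hbz, smul_smul, hinv, one_smul]

end MonoidActions

section Points

variable (Γ k : Type*) {L : Type*} [CommRing Γ] [Field k] [Field L] [Algebra Γ L] [Algebra k L]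

variable (L) in
/-- The automorphisms `σ` of `L` such that `σ⁻¹` maps the integral closure of `Γ` into itself.
Ideals of the integral closure can be pulled back along `σ⁻¹`, which gives an action of this
monoid. -/
def pullbackMonoid : Submonoid (L ≃ₐ[k] L) where
  carrier := {σ | ∀ x ∈ integralClosure Γ L, σ.symm x ∈ integralClosure Γ L}
  one_mem' _ hx := hx
  mul_mem' hσ hτ x hx := hτ _ (hσ x hx)

variable {Γ k}

/-- The restriction of `σ⁻¹` to the integral closure of `Γ`. -/
def pullbackHom (σ : pullbackMonoid Γ k L) : integralClosure Γ L →+* integralClosure Γ L where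
  toFun x := ⟨(σ : L ≃ₐ[k] L).symm x, σ.2 x x.2⟩
  map_one' := by ext; simp
  map_mul' _ _ := by ext; simp
  map_zero' := by ext; simp
  map_add' _ _ := by ext; simp

instance : MulAction (pullbackMonoid Γ k L) (Ideal (integralClosure Γ L)) where
  smul σ ℓ := ℓ.comap (pullbackHom σ)
  one_smul _ := rfl
  mul_smul _ _ _ := rfl

theorem mem_smul_ideal {σ : pullbackMonoid Γ k L} {ℓ : Ideal (integralClosure Γ L)}
    {x : integralClosure Γ L} : x ∈ σ • ℓ ↔ pullbackHom σ x ∈ ℓ := Iff.rfl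

theorem isPrime_smul (σ : pullbackMonoid Γ k L) {ℓ : Ideal (integralClosure Γ L)}
    (h : ℓ.IsPrime) : (σ • ℓ).IsPrime :=
  Ideal.IsPrime.comap (hK := h) (pullbackHom σ)

theorem translate_eq_smul (σ : pullbackMonoid Γ k L) (ℓ : Ideal (integralClosure Γ L)) :
    translate (σ : L ≃ₐ[k] L) ℓ = ((σ • ℓ : Ideal _) : Set (integralClosure Γ L)) := by
  ext x
  constructor
  · rintro ⟨y, hy, h⟩
    obtain rfl : y = pullbackHom σ x := Subtype.ext h
    exact hy
  · exact fun h => ⟨pullbackHom σ x, h, rfl⟩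

theorem finite_stabilizerIn {M : Submonoid (L ≃ₐ[k] L)} (hM : M ≤ pullbackMonoid Γ k L)
    {ℓ : Ideal (integralClosure Γ L)} (h : (stabilizer M ℓ).Finite) :
    (stabilizerIn hM ℓ : Set M).Finite := by
  refine (h.preimage Subtype.val_injective.injOn).subset fun a ha => ⟨a.2, ?_⟩
  exact (translate_eq_smul (Submonoid.inclusion hM a) ℓ).trans
    (congrArg SetLike.coe (mem_stabilizerIn.1 ha))

/-- The points of the spectrum of the integral closure of `Γ` in `L` that lie over `𝔪`. -/
def pointsOver (L : Type*) [Field L] [Algebra Γ L] (𝔪 : Ideal Γ) :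
    Set (Ideal (integralClosure Γ L)) :=
  {ℓ | ℓ.IsPrime ∧ ℓ.comap (algebraMap Γ (integralClosure Γ L)) = 𝔪}

theorem mem_pointsOver {𝔪 : Ideal Γ} (h𝔪 : 𝔪.IsMaximal) {ℓ : Ideal (integralClosure Γ L)}
    (hℓ : ℓ.IsPrime) (h : ∀ γ ∈ 𝔪, algebraMap Γ (integralClosure Γ L) γ ∈ ℓ) :
    ℓ ∈ pointsOver L 𝔪 :=
  ⟨hℓ, (h𝔪.eq_of_le (Ideal.IsPrime.comap _).ne_top h).symm⟩

theorem isMaximal_of_mem_pointsOver {ℓ : Ideal (integralClosure Γ L)} {𝔪 : Ideal Γ}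
    (h𝔪 : 𝔪.IsMaximal) (hℓ : ℓ ∈ pointsOver L 𝔪) : ℓ.IsMaximal :=
  have := hℓ.1
  Ideal.isMaximal_of_isIntegral_of_isMaximal_comap ℓ (hℓ.2 ▸ h𝔪)

theorem exists_isPrime_of_ker_le {R : Type*} [CommRing R] (e : R →+* integralClosure Γ L)
    (hΓ : ∀ γ : Γ, algebraMap Γ _ γ ∈ e.range) (Q : Ideal R) [hQ : Q.IsPrime]
    (hker : RingHom.ker e ≤ Q) :
    ∃ ℓ : Ideal (integralClosure Γ L), ℓ.IsPrime ∧ ∀ r, e r ∈ ℓ ↔ r ∈ Q := by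
  have hint : e.range.subtype.IsIntegral :=
    RingHom.IsIntegral.tower_top ((algebraMap Γ _).codRestrict e.range hΓ) e.range.subtype
      fun x => Algebra.IsIntegral.isIntegral (R := Γ) x
  let _ : Algebra e.range (integralClosure Γ L) := e.range.subtype.toAlgebra
  have : Algebra.IsIntegral e.range (integralClosure Γ L) := ⟨hint⟩
  have hsurj : Function.Surjective e.rangeRestrict := e.rangeRestrict_surjective
  have hker' : RingHom.ker e.rangeRestrict ≤ Q := e.ker_rangeRestrict.trans_le hker
  have : (Q.map e.rangeRestrict).IsPrime := Ideal.map_isPrime_of_surjective hsurj hker'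
  obtain ⟨ℓ, -, hℓ, hcomap⟩ := Ideal.exists_ideal_over_prime_of_isIntegral
    (S := integralClosure Γ L) (Q.map e.rangeRestrict) ⊥ fun x hx => by
      rw [show x = 0 from Subtype.ext hx]
      exact zero_mem _
  refine ⟨ℓ, hℓ, fun r => ?_⟩
  calc e r ∈ ℓ ↔ e.rangeRestrict r ∈ Q.map e.rangeRestrict := by rw [← hcomap]; rfl
    _ ↔ r ∈ Q := by
      rw [← Ideal.mem_comap, Ideal.comap_map_of_surjective' _ hsurj, sup_eq_left.2 hker']

section PairRing

variable {M : Submonoid (L ≃ₐ[k] L)} {C : Subalgebra Γ L}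

theorem symm_apply_mem_integralClosure (hM : M ≤ pullbackMonoid Γ k L)
    (hC : C ≤ integralClosure Γ L) (t : M) {a : M → L} (ha : a ∈ pairRing M C.toSubring) :
    (t : L ≃ₐ[k] L).symm (a t) ∈ integralClosure Γ L := by
  refine pairRing_le (S := (integralClosure Γ L).toSubring.toAddSubgroup.comap
    ((AddMonoidHomClass.toAddMonoidHom (t : L ≃ₐ[k] L).symm).comp
      (Pi.evalAddMonoidHom (fun _ : M => L) t))) (fun x hx y hy => ?_) ha
  change (t : L ≃ₐ[k] L).symm (x * (t : L ≃ₐ[k] L) y) ∈ integralClosure Γ L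
  rw [map_mul, AlgEquiv.symm_apply_apply]
  exact mul_mem (hM t.2 x (hC hx)) (hC hy)

/-- The ring homomorphism `a ↦ t⁻¹(a(t))`, which sends `x t(y)` to `t⁻¹(x) y`. -/
def symmEval (hM : M ≤ pullbackMonoid Γ k L) (hC : C ≤ integralClosure Γ L) (t : M) :
    pairRing M C.toSubring →+* integralClosure Γ L :=
  (((t : L ≃ₐ[k] L).symm : L →+* L).comp ((Pi.evalRingHom (fun _ : M => L) t).comp
    (pairRing M C.toSubring).subtype)).codRestrict (integralClosure Γ L)
      fun a => symm_apply_mem_integralClosure hM hC t a.2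

theorem symmEval_leftPair (hM : M ≤ pullbackMonoid Γ k L) (hC : C ≤ integralClosure Γ L) (t : M)
    (x : C) : symmEval hM hC t (leftPair M C.toSubring x) =
      pullbackHom (Submonoid.inclusion hM t) (Subalgebra.inclusion hC x) :=
  Subtype.ext (congrArg (t : L ≃ₐ[k] L).symm (leftPair_apply (C := C.toSubring) x t))

theorem symmEval_rightPair (hM : M ≤ pullbackMonoid Γ k L) (hC : C ≤ integralClosure Γ L) (t : M)
    (y : C) : symmEval hM hC t (rightPair M C.toSubring y) = Subalgebra.inclusion hC y :=
  Subtype.ext ((congrArg (t : L ≃ₐ[k] L).symm (rightPair_apply (C := C.toSubring) y t)).trans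
    ((t : L ≃ₐ[k] L).symm_apply_apply y))

theorem exists_isPrime_of_forall_vanish_mem (hM : M ≤ pullbackMonoid Γ k L)
    (hC : C ≤ integralClosure Γ L) (Q : Ideal (pairRing M C.toSubring)) [hQ : Q.IsPrime]
    (T : Finset M)
    (hT : vanishIdeal C.toSubring (T : Set M) ≤ Q) :
    ∃ t ∈ T, ∃ ℓ : Ideal (integralClosure Γ L), ℓ.IsPrime ∧
      (∀ y : C, Subalgebra.inclusion hC y ∈ ℓ ↔ rightPair M C.toSubring y ∈ Q) ∧
      ∀ x : C, Subalgebra.inclusion hC x ∈ Submonoid.inclusion hM t • ℓ ↔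
        leftPair M C.toSubring x ∈ Q := by
  have hle : T.inf (fun t => RingHom.ker (symmEval hM hC t)) ≤ Q := by
    intro a ha
    refine hT fun t ht => ?_
    have hta : symmEval hM hC t a = 0 :=
      Finset.inf_le (f := fun t => RingHom.ker (symmEval hM hC t)) ht ha
    exact (map_eq_zero_iff _ (t : L ≃ₐ[k] L).symm.injective).1 (congrArg Subtype.val hta)
  obtain ⟨t, ht, hker⟩ := (Ideal.IsPrime.inf_le' hQ).1 hle
  obtain ⟨ℓ, hℓ, hmem⟩ := exists_isPrime_of_ker_le (symmEval hM hC t)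
    (fun γ => ⟨_, symmEval_rightPair hM hC t (algebraMap Γ C γ)⟩) Q hker
  refine ⟨t, ht, ℓ, hℓ, fun y => ?_, fun x => ?_⟩
  · rw [← hmem, symmEval_rightPair]
  · rw [← hmem, symmEval_leftPair, mem_smul_ideal]

end PairRing

end Points

section GaloisPoints

variable {k Γ K L : Type*} [Field k] [CommRing Γ]
  [Field K] [Algebra k K] [Algebra Γ K] [Field L] [Algebra k L] [Algebra Γ L] [Algebra K L]
  [IsScalarTower k K L] [IsScalarTower Γ K L]

variable (Γ k) in
/-- The Galois group of `L/K` inside the monoid acting on the ideals of the integral closure. -/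
def galPullback : (L ≃ₐ[K] L) →* pullbackMonoid Γ k L where
  toFun g := ⟨g.restrictScalars k, fun _ hx => hx.map (g.symm.restrictScalars Γ)⟩
  map_one' := rfl
  map_mul' _ _ := rfl

theorem coe_galPullback (g : L ≃ₐ[K] L) :
    (galPullback k Γ g : L ≃ₐ[k] L) = g.restrictScalars k := rfl

variable (Γ K L) in
/-- The integral closure of `Γ` in `K`, as a subring of `L`. -/
def baseClosure : Subalgebra Γ L :=
  integralClosure Γ L ⊓ (IsScalarTower.toAlgHom Γ K L).range

theorem baseClosure_le : baseClosure Γ K L ≤ integralClosure Γ L := inf_le_left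

variable (K) in
/-- The restriction of an ideal of the integral closure of `Γ` in `L` to the integral closure of `Γ`
in `K`. -/
def underBase (ℓ : Ideal (integralClosure Γ L)) : Ideal (baseClosure Γ K L) :=
  ℓ.comap (Subalgebra.inclusion baseClosure_le)

theorem exists_galPullback_smul_eq [FiniteDimensional K L] [IsGalois K L]
    {ℓ ℓ' : Ideal (integralClosure Γ L)} (hℓ : ℓ.IsPrime) (hℓ' : ℓ'.IsPrime)
    (h : underBase K ℓ = underBase K ℓ') :
    ∃ g : L ≃ₐ[K] L, galPullback k Γ g • ℓ = ℓ' := by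
  let _ : Algebra (baseClosure Γ K L) (integralClosure Γ L) :=
    (Subalgebra.inclusion baseClosure_le).toAlgebra
  have : SMulCommClass (L ≃ₐ[K] L) Γ L := ⟨fun g γ x => map_smul (g.restrictScalars Γ) γ x⟩
  have : SMulCommClass (L ≃ₐ[K] L) (baseClosure Γ K L) (integralClosure Γ L) := by
    refine ⟨fun g c x => Subtype.ext ?_⟩
    obtain ⟨a, ha⟩ := c.2.2
    change g ((c : L) * x) = c * g x
    rw [map_mul, ← ha]
    exact congrArg (· * g x) (g.commutes a)
  have : Algebra.IsInvariant (baseClosure Γ K L) (integralClosure Γ L) (L ≃ₐ[K] L) := by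
    refine ⟨fun x hx => ?_⟩
    have hxK : (x : L) ∈ Set.range (algebraMap K L) :=
      (IsGalois.mem_range_algebraMap_iff_fixed _).2 fun g => congrArg Subtype.val (hx g)
    exact ⟨⟨x, x.2, hxK⟩, rfl⟩
  obtain ⟨g, hg⟩ := Algebra.IsInvariant.exists_smul_of_under_eq (baseClosure Γ K L)
    (integralClosure Γ L) (L ≃ₐ[K] L) ℓ ℓ' h
  refine ⟨g, ?_⟩
  ext x
  rw [hg, Ideal.mem_pointwise_smul_iff_inv_smul_mem]
  rfl

variable {M : Submonoid (L ≃ₐ[k] L)}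

theorem inv_mem_of_smul_galPullback_smul_eq [FiniteDimensional K L] (hconj : IsConjClosed K M)
    (hM : M ≤ pullbackMonoid Γ k L) {t e : M} (he : (e : L ≃ₐ[k] L)⁻¹ ∈ M) {f g : L ≃ₐ[K] L}
    {ℓ : Ideal (integralClosure Γ L)} (hfin : (stabilizerIn hM ℓ : Set M).Finite)
    (h : Submonoid.inclusion hM t • galPullback k Γ g • ℓ =
      galPullback k Γ f • Submonoid.inclusion hM e • ℓ) : (t : L ≃ₐ[k] L)⁻¹ ∈ M := by
  obtain ⟨s, hs⟩ : ∃ s : M, (s : L ≃ₐ[k] L) = conjAut f⁻¹ t := ⟨⟨_, hconj f⁻¹ t t.2⟩, rfl⟩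
  obtain ⟨e', he'⟩ : ∃ e' : M, (e' : L ≃ₐ[k] L) = (e : L ≃ₐ[k] L)⁻¹ := ⟨⟨_, he⟩, rfl⟩
  have hm : Submonoid.inclusion hM (e' * s) * galPullback k Γ (f⁻¹ * g) =
      Submonoid.inclusion hM e' *
        (galPullback k Γ f⁻¹ * (Submonoid.inclusion hM t * galPullback k Γ g)) := by
    ext x
    simp [hs, conjAut, coe_galPullback, AlgEquiv.aut_inv]
  have hee : Submonoid.inclusion hM e' * Submonoid.inclusion hM e = 1 := by
    ext x
    simp [he']
  have hff : galPullback k Γ f⁻¹ * galPullback k Γ f = 1 := by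
    rw [← map_mul, inv_mul_cancel, map_one]
  have hfix : (Submonoid.inclusion hM (e' * s) * galPullback k Γ (f⁻¹ * g)) • ℓ = ℓ := by
    rw [hm, mul_smul, mul_smul, mul_smul, h, ← mul_smul (galPullback k Γ f⁻¹), hff, one_smul,
      ← mul_smul, hee, one_smul]
  have hpow : galPullback k Γ (f⁻¹ * g) ^ Nat.card (L ≃ₐ[K] L) = 1 := by
    rw [← map_pow, pow_card_eq_one', map_one]
  have hnorm (a : L ≃ₐ[k] L) (ha : a ∈ M) :
      (galPullback k Γ (f⁻¹ * g) : L ≃ₐ[k] L) * a * (galPullback k Γ (f⁻¹ * g) : L ≃ₐ[k] L)⁻¹ ∈ M :=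
    hconj (f⁻¹ * g) a ha
  have hinv : ((e' * s : M) : L ≃ₐ[k] L)⁻¹ ∈ M :=
    inv_mem_of_mul_smul_eq hnorm Nat.card_pos.ne' hpow hfix hfin
  have hs' : (s : L ≃ₐ[k] L)⁻¹ ∈ M := right_inv_mem_of_mul e'.2 hinv
  have ht : conjAut f (s : L ≃ₐ[k] L)⁻¹ = (t : L ≃ₐ[k] L)⁻¹ := by
    ext x
    simp [hs, conjAut, AlgEquiv.aut_inv]
  exact ht ▸ hconj f _ hs'

theorem inv_mem_of_underBase_eq [FiniteDimensional K L] [IsGalois K L]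
    (hconj : IsConjClosed K M) (hM : M ≤ pullbackMonoid Γ k L) {t e : M}
    (he : (e : L ≃ₐ[k] L)⁻¹ ∈ M) {ℓ ℓ' : Ideal (integralClosure Γ L)} (hℓ : ℓ.IsPrime)
    (hℓ' : ℓ'.IsPrime) (hfin : (stabilizerIn hM ℓ : Set M).Finite)
    (h : underBase K ℓ' = underBase K ℓ)
    (h' : underBase K (Submonoid.inclusion hM t • ℓ') =
      underBase K (Submonoid.inclusion hM e • ℓ)) : (t : L ≃ₐ[k] L)⁻¹ ∈ M := by
  obtain ⟨g, hg⟩ := exists_galPullback_smul_eq (k := k) hℓ hℓ' h.symm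
  obtain ⟨f, hf⟩ :=
    exists_galPullback_smul_eq (k := k) (isPrime_smul _ hℓ) (isPrime_smul _ hℓ') h'.symm
  exact inv_mem_of_smul_galPullback_smul_eq hconj hM he hfin (hg ▸ hf.symm)

end GaloisPoints

section Finiteness

theorem finite_integralClosure_of_isIntegral (A F Γ L : Type*) [CommRing A] [IsDomain A]
    [IsIntegrallyClosed A] [IsNoetherianRing A] [Field F] [Algebra A F] [IsFractionRing A F]
    [Field L] [Algebra A L] [Algebra F L] [IsScalarTower A F L] [FiniteDimensional F L]
    [Algebra.IsSeparable F L] [CommRing Γ] [Algebra A Γ] [Algebra Γ L] [IsScalarTower A Γ L]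
    [Algebra.IsIntegral A Γ] : Module.Finite Γ (integralClosure Γ L) := by
  have : IsIntegralClosure (integralClosure Γ L) A L := by
    refine ⟨Subtype.val_injective, fun {x} => ⟨fun hx => ⟨⟨x, hx.tower_top⟩, rfl⟩, ?_⟩⟩
    rintro ⟨y, rfl⟩
    exact isIntegral_trans (R := A) (A := Γ) _ y.2
  have := IsIntegralClosure.finite A F L (integralClosure Γ L)
  exact Module.Finite.of_restrictScalars_finite A Γ (integralClosure Γ L)

theorem finite_integralClosure_of_finite (A Γ K L : Type*) [CommRing A] [IsDomain A] [CharZero A]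
    [IsIntegrallyClosed A] [IsNoetherianRing A] [CommRing Γ] [IsDomain Γ] [Algebra A Γ]
    [FaithfulSMul A Γ] [Module.Finite A Γ] [Field K] [Algebra Γ K] [IsFractionRing Γ K]
    [Algebra A K] [IsScalarTower A Γ K] [Field L] [Algebra Γ L] [Algebra K L]
    [FiniteDimensional K L] [Algebra A L] [IsScalarTower A Γ L] [IsScalarTower A K L] :
    Module.Finite Γ (integralClosure Γ L) := by
  have : FaithfulSMul A K := FaithfulSMul.trans A Γ K
  let F := FractionRing A
  let _ : Algebra F K := FractionRing.liftAlgebra A K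
  have : IsScalarTower A F K := FractionRing.isScalarTower_liftAlgebra A K
  let _ : Algebra F L := ((algebraMap K L).comp (algebraMap F K)).toAlgebra
  have : IsScalarTower F K L := IsScalarTower.of_algebraMap_eq fun _ => rfl
  have : IsScalarTower A F L := IsScalarTower.to₁₂₄ A F K L
  have : Module.Finite F K := Module.Finite.of_isLocalization A Γ (nonZeroDivisors A)
  have : FiniteDimensional F L := Module.Finite.trans K L
  exact finite_integralClosure_of_isIntegral A F Γ L

theorem finite_integralClosure (k Γ K L : Type*) [Field k] [CharZero k]
    [CommRing Γ] [IsDomain Γ] [Algebra k Γ] [Algebra.FiniteType k Γ]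
    [Field K] [Algebra Γ K] [IsFractionRing Γ K]
    [Field L] [Algebra Γ L] [Algebra K L] [IsScalarTower Γ K L] [FiniteDimensional K L] :
    Module.Finite Γ (integralClosure Γ L) := by
  obtain ⟨s, g, hinj, hfin⟩ := exists_finite_inj_algHom_of_fg k Γ
  let A := MvPolynomial (Fin s) k
  let _ : Algebra A Γ := g.toRingHom.toAlgebra
  have : Module.Finite A Γ := hfin
  have : FaithfulSMul A Γ := (faithfulSMul_iff_algebraMap_injective A Γ).2 hinj
  let _ : Algebra A K := ((algebraMap Γ K).comp (algebraMap A Γ)).toAlgebra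
  let _ : Algebra A L := ((algebraMap Γ L).comp (algebraMap A Γ)).toAlgebra
  have : IsScalarTower A Γ K := IsScalarTower.of_algebraMap_eq fun _ => rfl
  have : IsScalarTower A Γ L := IsScalarTower.of_algebraMap_eq fun _ => rfl
  have : IsScalarTower A K L := IsScalarTower.to₁₃₄ A Γ K L
  exact finite_integralClosure_of_finite A Γ K L

theorem finite_pointsOver {Γ L : Type*} [CommRing Γ] [Field L] [Algebra Γ L]
    [Module.Finite Γ (integralClosure Γ L)] (𝔪 : Ideal Γ) : (pointsOver L 𝔪).Finite := by
  refine (Algebra.QuasiFinite.finite_primesOver (S := integralClosure Γ L) 𝔪).subset ?_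
  rintro ℓ ⟨hℓ, h⟩
  exact ⟨hℓ, ⟨h.symm⟩⟩

theorem finite_baseClosure (Γ K L : Type*) [CommRing Γ] [Field K] [Algebra Γ K] [Field L]
    [Algebra Γ L] [Algebra K L] [IsScalarTower Γ K L] [IsNoetherianRing Γ]
    [Module.Finite Γ (integralClosure Γ L)] : Module.Finite Γ (baseClosure Γ K L) :=
  Module.Finite.of_injective (Subalgebra.inclusion (baseClosure_le (K := K))).toLinearMap
    (Subalgebra.inclusion_injective (baseClosure_le (K := K)))

theorem exists_conductor {Γ K L : Type*} [CommRing Γ] [IsDomain Γ] [Field K] [Algebra Γ K]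
    [IsFractionRing Γ K] [Field L] [Algebra Γ L] [Algebra K L] [IsScalarTower Γ K L]
    [Module.Finite Γ (baseClosure Γ K L)] :
    ∃ d : Γ, d ≠ 0 ∧ ∀ x ∈ baseClosure Γ K L, algebraMap Γ L d * x ∈ (algebraMap Γ L).range := by
  obtain ⟨s, hs⟩ : (baseClosure Γ K L).toSubmodule.FG :=
    Module.Finite.iff_fg.1 ‹Module.Finite Γ (baseClosure Γ K L)›
  have hK (x : s) : ∃ c : K, algebraMap K L c = x :=
    (hs.le (Submodule.subset_span x.2) : (x : L) ∈ baseClosure Γ K L).2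
  choose c hc using hK
  obtain ⟨d, hd⟩ := IsLocalization.exist_integer_multiples (nonZeroDivisors Γ) Finset.univ c
  have hle : Submodule.span Γ s ≤
      (LinearMap.range (Algebra.linearMap Γ L)).comap (LinearMap.mulLeft Γ (algebraMap Γ L d)) := by
    refine Submodule.span_le.2 fun x hx => ?_
    obtain ⟨γ, hγ⟩ := hd ⟨x, hx⟩ (Finset.mem_univ _)
    refine ⟨γ, ?_⟩
    have hx' : algebraMap K L (c ⟨x, hx⟩) = x := hc ⟨x, hx⟩
    change algebraMap Γ L γ = algebraMap Γ L d * x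
    rw [← hx', IsScalarTower.algebraMap_apply Γ K L γ, hγ, Algebra.smul_def, map_mul,
      ← IsScalarTower.algebraMap_apply]
  exact ⟨d, nonZeroDivisors.ne_zero d.2, fun x hx => hle (hs.ge hx)⟩

end Finiteness

section RightSpans

variable {k L : Type*} [Field k] [Field L] [Algebra k L] {M : Submonoid (L ≃ₐ[k] L)}

/-- The elements of `L * M` with support in `S`. -/
def supportedIn (S : Set M) : AddSubgroup (SkewMonoidAlgebra L M) where
  carrier := {w | ∀ t ∉ S, w.coeff t = 0}
  zero_mem' _ _ := rfl
  add_mem' hv hw t ht := by rw [coeff_add, Finsupp.add_apply, hv t ht, hw t ht, add_zero]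
  neg_mem' hw t ht := by rw [coeff_neg, Finsupp.neg_apply, hw t ht, neg_zero]

theorem mem_supportedIn_support (w : SkewMonoidAlgebra L M) : w ∈ supportedIn (w.support : Set M) :=
  fun _ ht => notMem_support_iff.1 ht

theorem scale_mem_supportedIn {S : Set M} (a : M → L) {w : SkewMonoidAlgebra L M}
    (hw : w ∈ supportedIn S) : scale a w ∈ supportedIn S := fun t ht => by
  rw [coeff_scale, hw t ht, mul_zero]

theorem single_mul_mem_supportedIn {S : Set M} (a : L) {w : SkewMonoidAlgebra L M}
    (hw : w ∈ supportedIn S) : single 1 a * w ∈ supportedIn S := fun t ht => by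
  rw [coeff_single_one_mul, hw t ht, mul_zero]

section CoeffRing

variable {A : Type*} [CommRing A] [Algebra A L]

theorem coeffHom_apply (a : A) : coeffHom A M a = single 1 (algebraMap A L a) := rfl

theorem rightCoeff_mul_coeffHom (w : SkewMonoidAlgebra L M) (a : A) :
    rightCoeff (w * coeffHom A M a) = a • rightCoeff w := by
  rw [coeffHom_apply, rightCoeff_mul_single_one, algebraMap_smul]

theorem map_rightSpan (s : Set (SkewMonoidAlgebra L M)) :
    (rightSpan (coeffRing A M) s).map rightCoeff =
      (Submodule.span A (rightCoeff '' s)).toAddSubgroup := by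
  refine le_antisymm (AddSubgroup.map_le_iff_le_comap.2 ((AddSubgroup.closure_le _).2 ?_)) ?_
  · rintro _ ⟨y, hy, _, ⟨a, rfl⟩, rfl⟩
    rw [SetLike.mem_coe, AddSubgroup.mem_comap, rightCoeff_mul_coeffHom]
    exact Submodule.smul_mem _ a (Submodule.subset_span ⟨y, hy, rfl⟩)
  · rw [← AddSubgroup.toAddSubmonoid_le, Submodule.toAddSubgroup_toAddSubmonoid,
      Submodule.span_eq_closure, AddSubmonoid.closure_le]
    rintro _ ⟨a, -, _, ⟨y, hy, rfl⟩, rfl⟩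
    exact ⟨y * coeffHom A M a, AddSubgroup.subset_closure ⟨y, hy, _, ⟨a, rfl⟩, rfl⟩,
      rightCoeff_mul_coeffHom y a⟩

theorem mem_rightSpan_iff {s : Set (SkewMonoidAlgebra L M)} {w : SkewMonoidAlgebra L M} :
    w ∈ rightSpan (coeffRing A M) s ↔ rightCoeff w ∈ Submodule.span A (rightCoeff '' s) := by
  rw [← AddSubgroup.mem_map_iff_mem rightCoeff_injective, map_rightSpan,
    Submodule.mem_toAddSubgroup]

theorem exists_finset_le_rightSpan {N : AddSubgroup (SkewMonoidAlgebra L M)}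
    (h : (Submodule.span A (rightCoeff '' (N : Set (SkewMonoidAlgebra L M)))).FG) :
    ∃ s : Finset (SkewMonoidAlgebra L M), (s : Set (SkewMonoidAlgebra L M)) ⊆ N ∧
      N ≤ rightSpan (coeffRing A M) (s : Set (SkewMonoidAlgebra L M)) := by
  classical
  obtain ⟨t, ht, hspan⟩ := (Submodule.fg_span_iff_fg_span_finset_subset _).1 h
  obtain ⟨s, hs, rfl⟩ := Finset.subset_set_image_iff.1 ht
  refine ⟨s, hs, fun w hw => mem_rightSpan_iff.2 ?_⟩
  rw [← Finset.coe_image, ← hspan]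
  exact Submodule.subset_span ⟨w, hw, rfl⟩

theorem fg_span_rightCoeff_of_le [IsNoetherianRing A] {N : AddSubgroup (SkewMonoidAlgebra L M)}
    {t : Finset (SkewMonoidAlgebra L M)}
    (h : N ≤ rightSpan (coeffRing A M) (t : Set (SkewMonoidAlgebra L M))) :
    (Submodule.span A (rightCoeff '' (N : Set (SkewMonoidAlgebra L M)))).FG := by
  refine (Submodule.fg_span (t.finite_toSet.image rightCoeff)).of_le (Submodule.span_le.2 ?_)
  rintro _ ⟨w, hw, rfl⟩
  exact mem_rightSpan_iff.1 (h hw)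

theorem fg_span_rightCoeff_of_scale_mem [IsNoetherianRing A]
    {N N' : AddSubgroup (SkewMonoidAlgebra L M)} {d : L} (hd : d ≠ 0)
    (h : ∀ w ∈ N, scale (pairFun M d d) w ∈ N')
    (hfg : (Submodule.span A (rightCoeff '' (N' : Set (SkewMonoidAlgebra L M)))).FG) :
    (Submodule.span A (rightCoeff '' (N : Set (SkewMonoidAlgebra L M)))).FG := by
  let f : (M → L) →ₗ[A] (M → L) := LinearMap.mulLeft A fun t => (t : L ≃ₐ[k] L).symm d * d
  have hf : Function.Injective f := fun x y hxy => funext fun t =>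
    mul_left_cancel₀ (mul_ne_zero ((map_ne_zero_iff _ (t : L ≃ₐ[k] L).symm.injective).2 hd) hd)
      (congrFun hxy t)
  have hcoeff (w : SkewMonoidAlgebra L M) :
      rightCoeff (scale (pairFun M d d) w) = f (rightCoeff w) := by
    funext t
    simp [f, rightCoeff_apply, pairFun_apply]
  refine Submodule.fg_of_fg_map_injective f hf (hfg.of_le ?_)
  rw [Submodule.map_span, Submodule.span_le]
  rintro _ ⟨_, ⟨w, hw, rfl⟩, rfl⟩
  exact Submodule.subset_span ⟨_, h w hw, hcoeff w⟩

end CoeffRing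

theorem fg_span_rightCoeff_of_le_supportedIn {K : Type*} [Field K] [Algebra K L]
    [FiniteDimensional K L] {S : Set M} (hS : S.Finite) {N : AddSubgroup (SkewMonoidAlgebra L M)}
    (hN : N ≤ supportedIn S) :
    (Submodule.span K (rightCoeff '' (N : Set (SkewMonoidAlgebra L M)))).FG := by
  classical
  have := hS.to_subtype
  have e := LinearMap.iInfKerProjEquiv K (fun _ : M => L) (disjoint_compl_right (a := S))
    (Set.union_compl_self S).ge
  have hfin := Module.Finite.equiv e.symm
  refine (Module.Finite.iff_fg.1 hfin).of_le (Submodule.span_le.2 ?_)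
  rintro _ ⟨w, hw, rfl⟩
  refine Submodule.mem_iInf _ |>.2 fun t => Submodule.mem_iInf _ |>.2 fun ht => ?_
  rw [LinearMap.mem_ker, LinearMap.proj_apply, rightCoeff_apply, hN hw t ht, map_zero]

end RightSpans

section Invariants

variable {k K L : Type*} [Field k] [Field K] [Field L]
  [Algebra k K] [Algebra k L] [Algebra K L] [IsScalarTower k K L]
  {M : Submonoid (L ≃ₐ[k] L)}

theorem galAct_galAct (hconj : IsConjClosed K M) (g h : L ≃ₐ[K] L) (w : SkewMonoidAlgebra L M) :
    galAct hconj g (galAct hconj h w) = galAct hconj (g * h) w := by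
  induction w using SkewMonoidAlgebra.induction_on with
  | zero => simp only [map_zero]
  | add v w hv hw => simp only [map_add, hv, hw]
  | single t a =>
    simp only [galAct_single]
    rfl

/-- The trace over the Galois group of the basis element `t`. -/
noncomputable def galTrace [FiniteDimensional K L] (hconj : IsConjClosed K M) (t : M) :
    SkewMonoidAlgebra L M :=
  ∑ g : L ≃ₐ[K] L, galAct hconj g (single t 1)

theorem galTrace_mem_invariants [FiniteDimensional K L] (hconj : IsConjClosed K M) (t : M) :
    galTrace hconj t ∈ invariants hconj := fun h => by
  simp only [galTrace, _root_.map_sum, galAct_galAct]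
  exact Fintype.sum_equiv (Equiv.mulLeft h) _ _ fun g => rfl

theorem coeff_galTrace_ne_zero [CharZero L] [FiniteDimensional K L] (hconj : IsConjClosed K M)
    (t : M) : (galTrace hconj t).coeff t ≠ 0 := by
  classical
  have h : (galTrace hconj t).coeff t =
      ∑ g : L ≃ₐ[K] L, if (⟨conjAut g t, hconj g t t.2⟩ : M) = t then (1 : L) else 0 := by
    rw [galTrace, ← coeffAddEquiv_apply, _root_.map_sum, Finsupp.finsetSum_apply]
    simp only [coeffAddEquiv_apply, galAct_single, coeff_single_apply, map_one]
  rw [h, Finset.sum_boole]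
  exact Nat.cast_ne_zero.2 (Finset.card_ne_zero_of_mem (a := 1)
    (Finset.mem_filter.2 ⟨Finset.mem_univ _, Subtype.ext (AlgEquiv.ext fun _ => rfl)⟩))

end Invariants

section Integrality

theorem isIntegral_of_forall_pow_mul_mem {A F : Type*} [CommRing A] [IsNoetherianRing A]
    [CommRing F] [IsDomain F] [Algebra A F] {N : Submodule A F} (hN : N.FG) {x v : F} (hv : v ≠ 0)
    (h : ∀ n : ℕ, x ^ n * v ∈ N) : IsIntegral A x := by
  have hle : (Algebra.adjoin A {x}).toSubmodule.map (LinearMap.mulRight A v) ≤ N := by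
    rw [Algebra.adjoin_eq_span, Submodule.map_span, Submodule.span_le]
    rintro _ ⟨y, hy, rfl⟩
    obtain ⟨n, rfl⟩ := Submonoid.mem_closure_singleton.1 hy
    exact h n
  have hfg : (Algebra.adjoin A {x}).toSubmodule.FG :=
    Submodule.fg_of_fg_map_injective _ (mul_left_injective₀ hv) (hN.of_le hle)
  exact IsIntegral.of_mem_of_fg _ hfg x (Algebra.self_mem_adjoin_singleton A x)

theorem mem_pullbackMonoid_of_forall_isIntegral {k Γ L : Type*} [Field k] [CommRing Γ] [Field L]
    [Algebra k L] [Algebra Γ L] {σ : L ≃ₐ[k] L}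
    (h : ∀ γ : Γ, IsIntegral Γ (σ.symm (algebraMap Γ L γ))) : σ ∈ pullbackMonoid Γ k L := by
  rintro y ⟨p, hp, hroot⟩
  let f : Γ →+* integralClosure Γ L :=
    ((σ.symm : L →+* L).comp (algebraMap Γ L)).codRestrict (integralClosure Γ L) h
  have hf : (algebraMap (integralClosure Γ L) L).comp f =
      (σ.symm : L →+* L).comp (algebraMap Γ L) := rfl
  refine isIntegral_trans (R := Γ) (A := integralClosure Γ L) _ ⟨p.map f, hp.map f, ?_⟩
  rw [Polynomial.eval₂_map, hf]
  refine (Polynomial.hom_eval₂ p (algebraMap Γ L) (σ.symm : L →+* L) y).symm.trans ?_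
  rw [hroot, map_zero]

end Integrality

section RightOrder

variable {k Γ K L : Type*} [Field k] [CommRing Γ]
  [Field K] [Algebra k K] [Field L] [Algebra k L] [Algebra Γ L] [Algebra K L]
  [IsScalarTower k K L]
  {M : Submonoid (L ≃ₐ[k] L)} {hconj : IsConjClosed K M} {U : Subring (SkewMonoidAlgebra L M)}

theorem IsGaloisRing.coeffHom_mem (hU : IsGaloisRing Γ hconj U) (γ : Γ) : coeffHom Γ M γ ∈ U :=
  (hU.incl γ).2

theorem IsGaloisRing.scale_mem (hU : IsGaloisRing Γ hconj U) {a : M → L}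
    (ha : a ∈ pairRing M (algebraMap Γ L).range) {u : SkewMonoidAlgebra L M} (hu : u ∈ U) :
    scale a u ∈ U := by
  refine GaloisOrder.scale_mem (U := U.toAddSubgroup) ?_ ha
  rintro _ ⟨x, rfl⟩ _ ⟨y, rfl⟩
  exact U.mul_mem (U.mul_mem (hU.coeffHom_mem x) hu) (hU.coeffHom_mem y)

theorem IsGaloisRing.exists_coeff_ne_zero [CharZero L] [FiniteDimensional K L]
    (hU : IsGaloisRing Γ hconj U) (t : M) : ∃ u ∈ U, u.coeff t ≠ 0 := by
  by_contra! hzero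
  have hle : leftSpan (coeffRing K M) (U : Set (SkewMonoidAlgebra L M)) ≤ supportedIn {t}ᶜ := by
    refine (AddSubgroup.closure_le _).2 ?_
    rintro _ ⟨_, ⟨c, rfl⟩, u, hu, rfl⟩
    refine single_mul_mem_supportedIn (algebraMap K L c) fun s hs => ?_
    rw [not_not.1 hs]
    exact hzero u hu
  have hmem : galTrace hconj t ∈ leftSpan (coeffRing K M) (U : Set (SkewMonoidAlgebra L M)) := by
    rw [hU.left_span]
    exact galTrace_mem_invariants hconj t
  exact coeff_galTrace_ne_zero hconj t (hle hmem t fun h => h rfl)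

theorem IsRightOrder.fg_span_rightCoeff [IsNoetherianRing Γ] [FiniteDimensional K L]
    (hR : IsRightOrder Γ hconj U) (hU : IsGaloisRing Γ hconj U) {S : Set M} (hS : S.Finite) :
    (Submodule.span Γ (rightCoeff ''
      ((U.toAddSubgroup ⊓ supportedIn S : AddSubgroup (SkewMonoidAlgebra L M)) :
        Set (SkewMonoidAlgebra L M)))).FG := by
  obtain ⟨s, hs, hle⟩ := exists_finset_le_rightSpan (fg_span_rightCoeff_of_le_supportedIn (K := K)
    hS (N := (invariants hconj).toAddSubgroup ⊓ supportedIn S) inf_le_right)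
  obtain ⟨t, ht⟩ := hR s fun w hw => (hs hw).1
  refine fg_span_rightCoeff_of_le (t := t) (ht ▸ le_inf ?_ inf_le_left)
  have hinv : U.toAddSubgroup ≤ (invariants hconj).toAddSubgroup := hU.le_invariants
  exact (inf_le_inf_right _ hinv).trans hle

theorem IsRightOrder.isIntegral_symm_algebraMap [IsNoetherianRing Γ] [CharZero L]
    [FiniteDimensional K L] (hR : IsRightOrder Γ hconj U) (hU : IsGaloisRing Γ hconj U) (t : M)
    (γ : Γ) : IsIntegral Γ ((t : L ≃ₐ[k] L).symm (algebraMap Γ L γ)) := by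
  obtain ⟨u, hu, hne⟩ := hU.exists_coeff_ne_zero t
  have hfg := (hR.fg_span_rightCoeff hU u.support.finite_toSet).map (LinearMap.proj t)
  refine isIntegral_of_forall_pow_mul_mem hfg (v := rightCoeff u t)
    ((map_ne_zero_iff _ (t : L ≃ₐ[k] L).symm.injective).2 hne) fun n => ?_
  refine ⟨rightCoeff (coeffHom Γ M (γ ^ n) * u), Submodule.subset_span ⟨_, ⟨?_, ?_⟩, rfl⟩, ?_⟩
  · exact U.mul_mem (hU.coeffHom_mem _) hu
  · exact single_mul_mem_supportedIn _ (mem_supportedIn_support u)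
  · rw [LinearMap.proj_apply, rightCoeff_apply, rightCoeff_apply, coeffHom_apply,
      coeff_single_one_mul, map_mul, map_pow, map_pow]

theorem IsRightOrder.le_pullbackMonoid [IsNoetherianRing Γ] [CharZero L] [FiniteDimensional K L]
    (hR : IsRightOrder Γ hconj U) (hU : IsGaloisRing Γ hconj U) : M ≤ pullbackMonoid Γ k L :=
  fun σ hσ => mem_pullbackMonoid_of_forall_isIntegral (hR.isIntegral_symm_algebraMap hU ⟨σ, hσ⟩)

end RightOrder

section Bounded

variable {k L : Type*} [Field k] [Field L] [Algebra k L] {M : Submonoid (L ≃ₐ[k] L)}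

/-- The elements `w` such that `d (a w) d` lies in `U` for every `a` in `pairRing M C`. If `d` is a
conductor of `C` in a smaller ring `D`, then they contain every `D`-bimodule `U`, they are stable
under `pairRing M C`, and they are as small as `U`. -/
def boundedBy (U : AddSubgroup (SkewMonoidAlgebra L M)) (C : Subring L) (d : L) :
    AddSubgroup (SkewMonoidAlgebra L M) where
  carrier := {w | ∀ a ∈ pairRing M C, scale (pairFun M d d * a) w ∈ U}
  zero_mem' a _ := by
    rw [map_zero]
    exact zero_mem U
  add_mem' hv hw a ha := by
    rw [map_add]
    exact add_mem (hv a ha) (hw a ha)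
  neg_mem' hw a ha := by
    rw [map_neg]
    exact neg_mem (hw a ha)

variable {U : AddSubgroup (SkewMonoidAlgebra L M)} {C : Subring L} {d : L}
  {w : SkewMonoidAlgebra L M}

theorem scale_mem_boundedBy {a : M → L} (ha : a ∈ pairRing M C) (hw : w ∈ boundedBy U C d) :
    scale a w ∈ boundedBy U C d := fun b hb => by
  rw [← scale_mul_apply, mul_assoc]
  exact hw _ (mul_mem hb ha)

theorem scale_mem_of_mem_boundedBy (hw : w ∈ boundedBy U C d) : scale (pairFun M d d) w ∈ U :=
  mul_one (pairFun M d d) ▸ hw 1 (one_mem _)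

theorem fg_span_rightCoeff_boundedBy {Γ : Type*} [CommRing Γ] [IsNoetherianRing Γ] [Algebra Γ L]
    (hd : d ≠ 0) {S : Set M}
    (hfg : (Submodule.span Γ (rightCoeff ''
      ((U ⊓ supportedIn S : AddSubgroup (SkewMonoidAlgebra L M)) :
        Set (SkewMonoidAlgebra L M)))).FG) :
    (Submodule.span Γ (rightCoeff ''
      ((boundedBy U C d ⊓ supportedIn S : AddSubgroup (SkewMonoidAlgebra L M)) :
        Set (SkewMonoidAlgebra L M)))).FG :=
  fg_span_rightCoeff_of_scale_mem hd (fun _ hw => AddSubgroup.mem_inf.2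
    ⟨scale_mem_of_mem_boundedBy hw.1, scale_mem_supportedIn _ hw.2⟩) hfg

theorem IsGaloisRing.mem_boundedBy {Γ K : Type*} [CommRing Γ] [Field K] [Algebra k K]
    [Algebra Γ L] [Algebra K L] [IsScalarTower k K L] {hconj : IsConjClosed K M}
    {U : Subring (SkewMonoidAlgebra L M)} (hU : IsGaloisRing Γ hconj U)
    (hd : ∀ x ∈ C, d * x ∈ (algebraMap Γ L).range) {u : SkewMonoidAlgebra L M} (hu : u ∈ U) :
    u ∈ boundedBy U.toAddSubgroup C d :=
  fun _ ha => hU.scale_mem (pairFun_mul_mem_pairRing hd ha) hu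

end Bounded

section LeftIdeals

variable {Γ A : Type*} [CommRing Γ] [Ring A] {φ : Γ →+* A}

theorem mul_mem_leftIdealGen_mul {𝔞 𝔟 : Ideal Γ} {x : A} (hx : x ∈ leftIdealGen φ 𝔞) {γ : Γ}
    (hγ : γ ∈ 𝔟) : x * φ γ ∈ leftIdealGen φ (𝔞 * 𝔟) := by
  have hle : leftIdealGen φ 𝔞 ≤
      (leftIdealGen φ (𝔞 * 𝔟)).comap (LinearMap.toSpanSingleton A A (φ γ)) := by
    refine Submodule.span_le.2 ?_
    rintro _ ⟨μ, hμ, rfl⟩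
    exact Submodule.subset_span ⟨μ * γ, Ideal.mul_mem_mul hμ hγ, map_mul φ μ γ⟩
  exact hle hx

theorem leftIdealGen_pow_eq_top {𝔪 : Ideal Γ} (h : leftIdealGen φ 𝔪 = ⊤) (n : ℕ) :
    leftIdealGen φ (𝔪 ^ n) = ⊤ := by
  induction n with
  | zero =>
    rw [pow_zero, Ideal.one_eq_top]
    exact (Ideal.eq_top_iff_one _).2 (Submodule.subset_span ⟨1, trivial, map_one φ⟩)
  | succ n ih =>
    refine top_unique (h.ge.trans (Submodule.span_le.2 ?_))
    rintro _ ⟨γ, hγ, rfl⟩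
    have hone : (1 : A) ∈ leftIdealGen φ (𝔪 ^ n) := ih ▸ Submodule.mem_top
    rw [pow_succ, ← one_mul (φ γ)]
    exact mul_mem_leftIdealGen_mul hone hγ

end LeftIdeals

section NoetherianModules

theorem fg_span_of_tower {R S V : Type*} [CommRing R] [CommRing S] [AddCommGroup V] [Algebra R S]
    [Module R V] [Module S V] [IsScalarTower R S V] {s : Set V} (h : (Submodule.span R s).FG) :
    (Submodule.span S s).FG := by
  obtain ⟨t, ht⟩ := h
  exact ⟨t, by rw [← Submodule.span_span_of_tower R S (t : Set V), ht,
    Submodule.span_span_of_tower]⟩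

theorem exists_smul_eq_of_forall_mem_pow_smul {R V : Type*} [CommRing R] [IsNoetherianRing R]
    [AddCommGroup V] [Module R V] {N : Submodule R V} (hN : N.FG) {𝔫 : Ideal R} {x : V} (hx : x ∈ N)
    (h : ∀ n : ℕ, x ∈ 𝔫 ^ n • N) : ∃ r ∈ 𝔫, r • x = x := by
  have : Module.Finite R N := Module.Finite.iff_fg.2 hN
  have hpow (n : ℕ) : (⟨x, hx⟩ : N) ∈ (𝔫 ^ n • ⊤ : Submodule R N) := by
    have hmap : (𝔫 ^ n • ⊤ : Submodule R N).map N.subtype = 𝔫 ^ n • N := by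
      rw [Submodule.map_smul'', Submodule.map_top, Submodule.range_subtype]
    obtain ⟨y, hy, hyx⟩ := hmap.ge (h n)
    obtain rfl : y = ⟨x, hx⟩ := Subtype.ext hyx
    exact hy
  obtain ⟨r, hr⟩ := (Ideal.mem_iInf_smul_pow_eq_bot_iff 𝔫 _).1 ((Submodule.mem_iInf _).2 hpow)
  exact ⟨r, r.2, congrArg Subtype.val hr⟩

end NoetherianModules

section UnitMovers

variable {k Γ K L : Type*} [Field k] [CommRing Γ]
  [Field K] [Algebra k K] [Algebra Γ K] [Field L] [Algebra k L] [Algebra Γ L] [Algebra K L]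
  [IsScalarTower k K L] [IsScalarTower Γ K L]
  {M : Submonoid (L ≃ₐ[k] L)} {hM : M ≤ pullbackMonoid Γ k L} {𝔪 : Ideal Γ}

/-- The invertible elements of `M` that move some point over `𝔪` to a point over `𝔪`. -/
def unitMovers (hM : M ≤ pullbackMonoid Γ k L) (𝔪 : Ideal Γ) : Set M :=
  {t | (t : L ≃ₐ[k] L)⁻¹ ∈ M ∧
    ∃ ℓ ∈ pointsOver L 𝔪, Submonoid.inclusion hM t • ℓ ∈ pointsOver L 𝔪}

theorem finite_unitMovers [Module.Finite Γ (integralClosure Γ L)]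
    (hfin : ∀ ℓ ∈ pointsOver L 𝔪, (stabilizerIn hM ℓ : Set M).Finite) :
    (unitMovers hM 𝔪).Finite := by
  refine ((finite_pointsOver 𝔪).biUnion fun ℓ hℓ => (finite_pointsOver 𝔪).biUnion fun ℓ' _ =>
    finite_setOf_inv_mem_and_smul_eq (z := ℓ') (hfin ℓ hℓ)).subset ?_
  rintro t ⟨ht, ℓ, hℓ, hℓ'⟩
  exact Set.mem_biUnion hℓ (Set.mem_biUnion hℓ' ⟨ht, rfl⟩)

theorem exists_mem_pointsOver [FaithfulSMul Γ L] (h𝔪 : 𝔪.IsMaximal) :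
    ∃ ℓ, ℓ ∈ pointsOver L 𝔪 := by
  have hinj : Function.Injective (algebraMap Γ (integralClosure Γ L)) :=
    Function.Injective.of_comp (f := Subtype.val) (FaithfulSMul.algebraMap_injective Γ L)
  obtain ⟨ℓ, hℓ, h⟩ := Ideal.exists_ideal_over_maximal_of_isIntegral (S := integralClosure Γ L) 𝔪
    (((RingHom.injective_iff_ker_eq_bot _).1 hinj).trans_le bot_le)
  exact ⟨ℓ, hℓ.isPrime, h⟩

theorem one_mem_unitMovers {ℓ : Ideal (integralClosure Γ L)} (hℓ : ℓ ∈ pointsOver L 𝔪) :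
    (1 : M) ∈ unitMovers hM 𝔪 :=
  ⟨by simp, ℓ, hℓ, by rwa [map_one, one_smul]⟩

theorem mem_pointsOver_of_underBase_eq (h𝔪 : 𝔪.IsMaximal) {ℓ ℓ' : Ideal (integralClosure Γ L)}
    (hℓ : ℓ ∈ pointsOver L 𝔪) (hℓ' : ℓ'.IsPrime) (h : underBase K ℓ' = underBase K ℓ) :
    ℓ' ∈ pointsOver L 𝔪 :=
  mem_pointsOver h𝔪 hℓ' fun γ hγ => by
    have hγℓ : algebraMap Γ (baseClosure Γ K L) γ ∈ underBase K ℓ := hℓ.2.ge hγ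
    rwa [← h] at hγℓ

variable (K) in
theorem isMaximal_underBase (h𝔪 : 𝔪.IsMaximal) {ℓ : Ideal (integralClosure Γ L)}
    (hℓ : ℓ ∈ pointsOver L 𝔪) : (underBase K ℓ).IsMaximal := by
  have hint : (Subalgebra.inclusion (baseClosure_le (Γ := Γ) (K := K) (L := L)) :
      baseClosure Γ K L →+* integralClosure Γ L).IsIntegral :=
    RingHom.IsIntegral.tower_top (algebraMap Γ (baseClosure Γ K L)) _
      fun x => Algebra.IsIntegral.isIntegral (R := Γ) x
  have := isMaximal_of_mem_pointsOver h𝔪 hℓ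
  exact Ideal.isMaximal_comap_of_isIntegral_of_isMaximal' _ hint ℓ

theorem exists_mem_vanishIdeal_evalOne_notMem [FiniteDimensional K L] [IsGalois K L]
    (hconj : IsConjClosed K M) (h𝔪 : 𝔪.IsMaximal)
    (hfin : ∀ ℓ ∈ pointsOver L 𝔪, (stabilizerIn hM ℓ : Set M).Finite)
    {ℓ₀ : Ideal (integralClosure Γ L)} (hℓ₀ : ℓ₀ ∈ pointsOver L 𝔪) {T : Finset M}
    (hT : ∀ t ∈ T, t ∉ unitMovers hM 𝔪) :
    ∃ a ∈ vanishIdeal (baseClosure Γ K L).toSubring (T : Set M),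
      evalOne M (baseClosure Γ K L).toSubring a ∉ underBase K ℓ₀ := by
  by_contra! hcon
  have := (isMaximal_underBase K h𝔪 hℓ₀).isPrime
  have hQ : ((underBase K ℓ₀).comap (evalOne M (baseClosure Γ K L).toSubring)).IsPrime :=
    Ideal.IsPrime.comap _
  obtain ⟨t, ht, ℓ, hℓ, hright, hleft⟩ := exists_isPrime_of_forall_vanish_mem hM baseClosure_le
    ((underBase K ℓ₀).comap (evalOne M (baseClosure Γ K L).toSubring)) T fun a ha => hcon a ha
  have hright' : underBase K ℓ = underBase K ℓ₀ := by
    ext y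
    refine (hright y).trans ?_
    rw [Ideal.mem_comap, evalOne_rightPair]
  have hleft' : underBase K (Submonoid.inclusion hM t • ℓ) = underBase K ℓ₀ := by
    ext x
    refine (hleft x).trans ?_
    rw [Ideal.mem_comap, evalOne_leftPair]
  refine hT t ht ⟨?_, ℓ, mem_pointsOver_of_underBase_eq h𝔪 hℓ₀ hℓ hright',
    mem_pointsOver_of_underBase_eq h𝔪 hℓ₀ (isPrime_smul _ hℓ) hleft'⟩
  exact inv_mem_of_underBase_eq (e := 1) hconj hM (by simp) hℓ₀.1 hℓ (hfin ℓ₀ hℓ₀) hright'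
    (by rw [hleft', map_one, one_smul])

theorem exists_mem_vanishIdeal_one_sub_evalOne_mem_pow [FiniteDimensional K L] [IsGalois K L]
    (hconj : IsConjClosed K M) (h𝔪 : 𝔪.IsMaximal)
    (hfin : ∀ ℓ ∈ pointsOver L 𝔪, (stabilizerIn hM ℓ : Set M).Finite)
    {ℓ₀ : Ideal (integralClosure Γ L)} (hℓ₀ : ℓ₀ ∈ pointsOver L 𝔪) {T : Finset M}
    (hT : ∀ t ∈ T, t ∉ unitMovers hM 𝔪) (n : ℕ) :
    ∃ a ∈ vanishIdeal (baseClosure Γ K L).toSubring (T : Set M),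
      1 - evalOne M (baseClosure Γ K L).toSubring a ∈ underBase K ℓ₀ ^ n := by
  obtain ⟨b, hb, hbℓ₀⟩ := exists_mem_vanishIdeal_evalOne_notMem hconj h𝔪 hfin hℓ₀ hT
  let eval : pairRing M (baseClosure Γ K L).toSubring →+* baseClosure Γ K L := evalOne M _
  have hsurj : Function.Surjective eval := fun x => ⟨leftPair M _ x, evalOne_leftPair _⟩
  have hle : ¬ (vanishIdeal _ (T : Set M)).map eval ≤ underBase K ℓ₀ :=
    fun h => hbℓ₀ (h (Ideal.mem_map_of_mem eval hb))
  have hsup := Ideal.sup_pow_eq_top (n := n)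
    ((isMaximal_underBase K h𝔪 hℓ₀).out.2 _ (right_lt_sup.2 hle))
  obtain ⟨c, hc, r, hr, hcr⟩ := Submodule.mem_sup.1 ((Ideal.eq_top_iff_one _).1 hsup)
  obtain ⟨a, ha, rfl⟩ := (Ideal.mem_map_iff_of_surjective eval hsurj).1 hc
  exact ⟨a, ha, (eq_sub_of_add_eq' hcr) ▸ hr⟩

end UnitMovers

section ProperLeftIdeal

variable {k Γ K L : Type*} [Field k] [CommRing Γ]
  [Field K] [Algebra k K] [Algebra Γ K] [Field L] [Algebra k L] [Algebra Γ L] [Algebra K L]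
  [IsScalarTower k K L] [IsScalarTower Γ K L]
  {M : Submonoid (L ≃ₐ[k] L)} {U : Subring (SkewMonoidAlgebra L M)}

theorem scale_mem_supportedIn_of_forall {S : Set M} {a : M → L} {w : SkewMonoidAlgebra L M}
    (h : ∀ t ∉ S, w.coeff t ≠ 0 → a t = 0) : scale a w ∈ supportedIn S := fun t ht =>
  mul_eq_zero.2 (or_iff_not_imp_right.2 (h t ht))

theorem rightCoeff_scale_one (a : M → L) : rightCoeff (scale a 1) = a 1 • rightCoeff 1 := by
  funext t
  rw [Pi.smul_apply, rightCoeff_apply, rightCoeff_apply, coeff_scale]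
  by_cases ht : t = 1
  · subst ht
    rw [coeff_one, Finsupp.single_eq_same, mul_one, map_one, smul_eq_mul, mul_one]
    rfl
  · rw [coeff_one, Finsupp.single_eq_of_ne ht, mul_zero, map_zero, smul_zero]

theorem rightCoeff_scale_mul_coeffHom (a : M → L) (w : SkewMonoidAlgebra L M) (γ : Γ) :
    rightCoeff (scale a (w * coeffHom Γ M γ)) = γ • rightCoeff (scale a w) := by
  rw [coeffHom_apply, scale_mul_single_one, ← coeffHom_apply, rightCoeff_mul_coeffHom]

variable (Γ K) in
/-- The module generated by the right coefficients of the elements supported in `S` that are bounded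
by `U` with conductor `d`. -/
noncomputable def boundedSpan (U : Subring (SkewMonoidAlgebra L M)) (d : Γ) (S : Set M) :
    Submodule (baseClosure Γ K L) (M → L) :=
  Submodule.span _ (rightCoeff '' ((boundedBy U.toAddSubgroup (baseClosure Γ K L).toSubring
    (algebraMap Γ L d) ⊓ supportedIn S : AddSubgroup (SkewMonoidAlgebra L M)) :
      Set (SkewMonoidAlgebra L M)))

variable {hconj : IsConjClosed K M}

theorem fg_boundedSpan [IsNoetherianRing Γ] [FiniteDimensional K L] [FaithfulSMul Γ L]
    (hU : IsGaloisRing Γ hconj U) (hR : IsRightOrder Γ hconj U) {d : Γ} (hd : d ≠ 0) {S : Set M}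
    (hS : S.Finite) : (boundedSpan Γ K U d S).FG :=
  fg_span_of_tower (fg_span_rightCoeff_boundedBy
    ((map_ne_zero_iff _ (FaithfulSMul.algebraMap_injective Γ L)).2 hd)
    (hR.fg_span_rightCoeff hU hS))

theorem rightCoeff_scale_mem_boundedSpan (hU : IsGaloisRing Γ hconj U) {d : Γ}
    (hd : ∀ x ∈ baseClosure Γ K L, algebraMap Γ L d * x ∈ (algebraMap Γ L).range) {S : Set M}
    {a : M → L} (ha : a ∈ pairRing M (baseClosure Γ K L).toSubring)
    {u : SkewMonoidAlgebra L M} (hu : u ∈ U) (h : ∀ t ∉ S, u.coeff t ≠ 0 → a t = 0) :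
    rightCoeff (scale a u) ∈ boundedSpan Γ K U d S :=
  Submodule.subset_span ⟨_, AddSubgroup.mem_inf.2 ⟨scale_mem_boundedBy ha (hU.mem_boundedBy hd hu),
    scale_mem_supportedIn_of_forall h⟩, rfl⟩

theorem exists_forall_rightCoeff_scale_mem_smul (hU : IsGaloisRing Γ hconj U) {d : Γ}
    (hd : ∀ x ∈ baseClosure Γ K L, algebraMap Γ L d * x ∈ (algebraMap Γ L).range) (S : Set M)
    {𝔞 : Ideal Γ} {x : U} (hx : x ∈ leftIdealGen hU.incl 𝔞) :
    ∃ T : Finset M, (∀ t ∈ T, t ∉ S) ∧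
      ∀ a ∈ vanishIdeal (baseClosure Γ K L).toSubring (T : Set M),
        rightCoeff (scale (a : M → L) (x : SkewMonoidAlgebra L M)) ∈
          𝔞.map (algebraMap Γ (baseClosure Γ K L)) • boundedSpan Γ K U d S := by
  classical
  induction hx using Submodule.closure_induction with
  | zero => exact ⟨∅, by simp, fun a _ => by simp⟩
  | add x y _ _ hx hy =>
    obtain ⟨T, hTS, hT⟩ := hx
    obtain ⟨T', hTS', hT'⟩ := hy
    refine ⟨T ∪ T', fun t ht => (Finset.mem_union.1 ht).elim (hTS t) (hTS' t), fun a ha => ?_⟩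
    rw [Subring.coe_add, map_add, map_add]
    exact add_mem (hT a fun t ht => ha t (Finset.mem_union_left _ ht))
      (hT' a fun t ht => ha t (Finset.mem_union_right _ ht))
  | smul_mem u x hx =>
    obtain ⟨γ, hγ, rfl⟩ := hx
    refine ⟨(u : SkewMonoidAlgebra L M).support.filter (· ∉ S), fun t ht =>
      (Finset.mem_filter.1 ht).2, fun a ha => ?_⟩
    have hγu : rightCoeff (scale (a : M → L) ((u • hU.incl γ : U) : SkewMonoidAlgebra L M)) =
        algebraMap Γ (baseClosure Γ K L) γ •
          rightCoeff (scale (a : M → L) (u : SkewMonoidAlgebra L M)) := by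
      rw [algebraMap_smul]
      exact rightCoeff_scale_mul_coeffHom _ _ γ
    rw [hγu]
    refine Submodule.smul_mem_smul (Ideal.mem_map_of_mem _ hγ)
      (rightCoeff_scale_mem_boundedSpan hU hd a.2 u.2 fun t ht hne => ha t ?_)
    exact Finset.mem_coe.2 (Finset.mem_filter.2 ⟨mem_support_iff.2 hne, ht⟩)

theorem rightCoeff_one_mem_boundedSpan (hU : IsGaloisRing Γ hconj U) {d : Γ}
    (hd : ∀ x ∈ baseClosure Γ K L, algebraMap Γ L d * x ∈ (algebraMap Γ L).range) {S : Set M}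
    (hS : 1 ∈ S) : rightCoeff 1 ∈ boundedSpan Γ K U d S := by
  have h := rightCoeff_scale_mem_boundedSpan hU hd (S := S) (one_mem (pairRing M _)) U.one_mem
    fun t ht hne => absurd (Finsupp.single_eq_of_ne (ne_of_mem_of_not_mem hS ht).symm) hne
  rwa [map_one scale] at h

theorem rightCoeff_one_mem_pow_smul [FiniteDimensional K L] [IsGalois K L]
    (hU : IsGaloisRing Γ hconj U) (hM : M ≤ pullbackMonoid Γ k L) {d : Γ}
    (hd : ∀ x ∈ baseClosure Γ K L, algebraMap Γ L d * x ∈ (algebraMap Γ L).range) {𝔪 : Ideal Γ}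
    (h𝔪 : 𝔪.IsMaximal) (hfin : ∀ ℓ ∈ pointsOver L 𝔪, (stabilizerIn hM ℓ : Set M).Finite)
    {ℓ : Ideal (integralClosure Γ L)} (hℓ : ℓ ∈ pointsOver L 𝔪) {n : ℕ}
    (h : 1 ∈ leftIdealGen hU.incl (𝔪 ^ n)) :
    rightCoeff 1 ∈ underBase K ℓ ^ n • boundedSpan Γ K U d (unitMovers hM 𝔪) := by
  obtain ⟨T, hTS, hT⟩ := exists_forall_rightCoeff_scale_mem_smul hU hd (unitMovers hM 𝔪) h
  obtain ⟨a, ha, haℓ⟩ := exists_mem_vanishIdeal_one_sub_evalOne_mem_pow hconj h𝔪 hfin hℓ hTS n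
  let c : baseClosure Γ K L := evalOne M _ a
  have hdecomp : (rightCoeff 1 : M → L) =
      (1 - c) • rightCoeff 1 + rightCoeff (scale (a : M → L) 1) := by
    rw [rightCoeff_scale_one, sub_smul, one_smul]
    exact (sub_add_cancel _ _).symm
  have hle : (𝔪 ^ n).map (algebraMap Γ (baseClosure Γ K L)) ≤ underBase K ℓ ^ n := by
    have h𝔪ℓ : 𝔪 ≤ (underBase K ℓ).comap (algebraMap Γ (baseClosure Γ K L)) := hℓ.2.ge
    rw [Ideal.map_pow]
    exact Ideal.pow_right_mono (Ideal.map_le_iff_le_comap.2 h𝔪ℓ) n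
  rw [hdecomp]
  exact add_mem
    (Submodule.smul_mem_smul haℓ (rightCoeff_one_mem_boundedSpan hU hd (one_mem_unitMovers hℓ)))
    (Submodule.smul_mono_left hle (hT a ha))

theorem leftIdealGen_ne_top [IsDomain Γ] [IsFractionRing Γ K] [IsNoetherianRing Γ]
    [FiniteDimensional K L] [IsGalois K L] [Module.Finite Γ (integralClosure Γ L)]
    (hU : IsGaloisRing Γ hconj U) (hR : IsRightOrder Γ hconj U) (hM : M ≤ pullbackMonoid Γ k L)
    {𝔪 : Ideal Γ} (h𝔪 : 𝔪.IsMaximal)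
    (hfin : ∀ ℓ ∈ pointsOver L 𝔪, (stabilizerIn hM ℓ : Set M).Finite) :
    leftIdealGen hU.incl 𝔪 ≠ ⊤ := by
  intro htop
  have : FaithfulSMul Γ L := FaithfulSMul.trans Γ K L
  have := finite_baseClosure Γ K L
  have : IsNoetherianRing (baseClosure Γ K L) := IsNoetherianRing.of_finite Γ _
  obtain ⟨d, hd0, hd⟩ := exists_conductor (Γ := Γ) (K := K) (L := L)
  obtain ⟨ℓ, hℓ⟩ := exists_mem_pointsOver (L := L) h𝔪
  obtain ⟨r, hr, hr1⟩ := exists_smul_eq_of_forall_mem_pow_smul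
    (fg_boundedSpan hU hR hd0 (finite_unitMovers hfin))
    (rightCoeff_one_mem_boundedSpan hU hd (one_mem_unitMovers hℓ))
    fun n => rightCoeff_one_mem_pow_smul hU hM hd h𝔪 hfin hℓ (n := n)
      (leftIdealGen_pow_eq_top htop n ▸ Submodule.mem_top)
  have hone : r = 1 := by
    have h := congrFun hr1 1
    rw [Pi.smul_apply, rightCoeff_apply, coeff_one, Finsupp.single_eq_same, map_one] at h
    exact Subtype.ext ((mul_one (r : L)).symm.trans h)
  exact (isMaximal_underBase K h𝔪 hℓ).ne_top ((Ideal.eq_top_iff_one _).2 (hone ▸ hr))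

end ProperLeftIdeal

section PowTorsion

variable {Γ V : Type*} [CommRing Γ] [AddCommGroup V] [Module Γ V]

variable (V) in
/-- The vectors that are killed by some power of `𝔞`. -/
def powTorsion (𝔞 : Ideal Γ) : Submodule Γ V where
  carrier := {v | ∃ n : ℕ, ∀ γ ∈ 𝔞 ^ n, γ • v = 0}
  zero_mem' := ⟨0, fun γ _ => smul_zero γ⟩
  add_mem' := by
    rintro v w ⟨m, hm⟩ ⟨n, hn⟩
    refine ⟨max m n, fun γ hγ => ?_⟩
    rw [smul_add, hm γ (Ideal.pow_le_pow_right (le_max_left m n) hγ),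
      hn γ (Ideal.pow_le_pow_right (le_max_right m n) hγ), add_zero]
  smul_mem' := by
    rintro δ v ⟨n, hn⟩
    exact ⟨n, fun γ hγ => by rw [smul_comm, hn γ hγ, smul_zero]⟩

variable (V) in
/-- The vectors that are killed by some ideal coprime to `𝔞`. They contain the torsion at every
other maximal ideal if `𝔞` is maximal. -/
def coprimeTorsion (𝔞 : Ideal Γ) : Submodule Γ V where
  carrier := {v | ∃ 𝔟 : Ideal Γ, 𝔞 ⊔ 𝔟 = ⊤ ∧ ∀ γ ∈ 𝔟, γ • v = 0}
  zero_mem' := ⟨⊤, sup_top_eq 𝔞, fun γ _ => smul_zero γ⟩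
  add_mem' := by
    rintro v w ⟨𝔟, h𝔟, hv⟩ ⟨𝔠, h𝔠, hw⟩
    refine ⟨𝔟 * 𝔠, (Ideal.sup_mul_eq_of_coprime_left h𝔟).trans h𝔠, fun γ hγ => ?_⟩
    obtain ⟨hb, hc⟩ := Ideal.mul_le_inf hγ
    rw [smul_add, hv γ hb, hw γ hc, add_zero]
  smul_mem' := by
    rintro δ v ⟨𝔟, h𝔟, hv⟩
    exact ⟨𝔟, h𝔟, fun γ hγ => by rw [smul_comm, hv γ hγ, smul_zero]⟩

theorem disjoint_powTorsion_coprimeTorsion (𝔞 : Ideal Γ) :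
    Disjoint (powTorsion V 𝔞) (coprimeTorsion V 𝔞) := by
  refine Submodule.disjoint_def.2 ?_
  rintro v ⟨n, hv⟩ ⟨𝔟, h𝔟, hv'⟩
  obtain ⟨a, ha, b, hb, hab⟩ := Submodule.mem_sup.1
    ((Ideal.eq_top_iff_one _).1 (Ideal.pow_sup_eq_top (n := n) h𝔟))
  rw [← one_smul Γ v, ← hab, add_smul, hv a ha, hv' b hb, add_zero]

theorem sup_eq_top_of_ne {𝔪 𝔫 : MaximalSpectrum Γ} (h : 𝔪 ≠ 𝔫) : 𝔪.asIdeal ⊔ 𝔫.asIdeal = ⊤ :=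
  𝔪.isMaximal.coprime_of_ne 𝔫.isMaximal fun h' => h (MaximalSpectrum.ext h')

theorem iSupIndep_powTorsion :
    iSupIndep fun 𝔪 : MaximalSpectrum Γ => powTorsion V 𝔪.asIdeal := fun 𝔪 =>
  (disjoint_powTorsion_coprimeTorsion 𝔪.asIdeal).mono_right <| by
    refine iSup₂_le fun 𝔫 h𝔫 => ?_
    rintro v ⟨n, hv⟩
    exact ⟨𝔫.asIdeal ^ n, Ideal.sup_pow_eq_top (sup_eq_top_of_ne h𝔫.symm), hv⟩

theorem exists_prod_maximal_le (𝔞 : Ideal Γ) [IsArtinianRing (Γ ⧸ 𝔞)] :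
    ∃ Z : Multiset (MaximalSpectrum Γ), (Z.map MaximalSpectrum.asIdeal).prod ≤ 𝔞 := by
  obtain ⟨Z, hZ⟩ := PrimeSpectrum.exists_primeSpectrum_prod_le _ (⊥ : Ideal (Γ ⧸ 𝔞))
  let π := Ideal.Quotient.mk 𝔞
  have hπ : Function.Surjective π := Ideal.Quotient.mk_surjective
  have hmax (P : PrimeSpectrum (Γ ⧸ 𝔞)) : (P.asIdeal.comap π).IsMaximal :=
    have : P.asIdeal.IsMaximal := inferInstance
    Ideal.comap_isMaximal_of_surjective π hπ
  refine ⟨Z.map fun P => ⟨P.asIdeal.comap π, hmax P⟩, ?_⟩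
  have hmap : ((Z.map fun P : PrimeSpectrum (Γ ⧸ 𝔞) => P.asIdeal.comap π).prod).map π ≤ ⊥ := by
    rw [← Ideal.mapHom_apply, map_multiset_prod, Multiset.map_map]
    exact (congrArg Multiset.prod (Multiset.map_congr rfl fun (P : PrimeSpectrum (Γ ⧸ 𝔞)) _ =>
      Ideal.map_comap_of_surjective π hπ P.asIdeal)).trans_le hZ
  rw [Ideal.map_le_iff_le_comap, ← RingHom.ker_eq_comap_bot, Ideal.mk_ker] at hmap
  rwa [Multiset.map_map]

theorem mem_iSup_powTorsion {𝔞 : Ideal Γ} [IsArtinianRing (Γ ⧸ 𝔞)] {v : V}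
    (hv : ∀ γ ∈ 𝔞, γ • v = 0) :
    v ∈ ⨆ 𝔪 : MaximalSpectrum Γ, powTorsion V 𝔪.asIdeal := by
  classical
  obtain ⟨Z, hZ⟩ := exists_prod_maximal_le 𝔞
  let p (𝔪 : MaximalSpectrum Γ) : Ideal Γ := 𝔪.asIdeal ^ Z.count 𝔪
  have hp : (Z.toFinset : Set (MaximalSpectrum Γ)).Pairwise fun 𝔪 𝔫 => p 𝔪 ⊔ p 𝔫 = ⊤ :=
    fun 𝔪 _ 𝔫 _ h => Ideal.pow_sup_pow_eq_top (sup_eq_top_of_ne h)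
  have hmem : v ∈ Submodule.torsionBySet Γ V ((⨅ 𝔪 ∈ Z.toFinset, p 𝔪 : Ideal Γ) : Set Γ) := by
    rw [Submodule.mem_torsionBySet_iff]
    rintro ⟨γ, hγ⟩
    rw [← Ideal.prod_eq_iInf_of_pairwise_isCoprime
      fun 𝔪 h𝔪 𝔫 h𝔫 h => Ideal.isCoprime_iff_sup_eq.2 (hp h𝔪 h𝔫 h),
      ← Finset.prod_multiset_map_count] at hγ
    exact hv γ (hZ hγ)
  rw [← Submodule.iSup_torsionBySet_ideal_eq_torsionBySet_iInf hp] at hmem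
  have hle : ⨆ 𝔪 ∈ Z.toFinset, Submodule.torsionBySet Γ V (p 𝔪 : Set Γ) ≤
      ⨆ 𝔪 : MaximalSpectrum Γ, powTorsion V 𝔪.asIdeal := by
    refine iSup₂_le fun 𝔪 _ => le_trans (fun w hw => ?_) (le_iSup _ 𝔪)
    exact ⟨Z.count 𝔪, fun γ hγ => (Submodule.mem_torsionBySet_iff _ _).1 hw ⟨γ, hγ⟩⟩
  exact hle hmem

theorem isInternal_powTorsion [DecidableEq (MaximalSpectrum Γ)]
    (hV : ∀ v : V, ∃ 𝔞 : Ideal Γ, IsArtinianRing (Γ ⧸ 𝔞) ∧ ∀ γ ∈ 𝔞, γ • v = 0) :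
    DirectSum.IsInternal fun 𝔪 : MaximalSpectrum Γ => powTorsion V 𝔪.asIdeal := by
  refine DirectSum.isInternal_submodule_of_iSupIndep_of_iSup_eq_top iSupIndep_powTorsion ?_
  refine (Submodule.eq_top_iff').2 fun v => ?_
  obtain ⟨𝔞, _, hv⟩ := hV v
  exact mem_iSup_powTorsion hv

end PowTorsion

section CyclicModule

variable {Γ A : Type*} [CommRing Γ] [Ring A] {I : Submodule A A}

theorem smul_mk_one_eq_zero_iff {a : A} : a • (Submodule.Quotient.mk 1 : A ⧸ I) = 0 ↔ a ∈ I := by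
  rw [← Submodule.Quotient.mk_smul, smul_eq_mul, mul_one, Submodule.Quotient.mk_eq_zero]

theorem weightSpace_quotient_ne_bot {φ : Γ →+* A} {𝔪 : Ideal Γ}
    (hI : I ≠ ⊤) (hI𝔪 : ∀ γ ∈ 𝔪, φ γ ∈ I) : weightSpace φ (A ⧸ I) 𝔪 ≠ ⊥ := fun hbot => by
  have hone : (Submodule.Quotient.mk 1 : A ⧸ I) ∈ weightSpace φ (A ⧸ I) 𝔪 :=
    ⟨1, fun γ hγ => smul_mk_one_eq_zero_iff.2 (hI𝔪 γ (pow_one 𝔪 ▸ hγ))⟩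
  rw [hbot, AddSubgroup.mem_bot, Submodule.Quotient.mk_eq_zero] at hone
  exact hI ((Ideal.eq_top_iff_one I).2 hone)

end CyclicModule

section Nullstellensatz

variable {k Γ A V : Type*} [Field k] [IsAlgClosed k] [CommRing Γ] [Algebra k Γ]
  [Algebra.FiniteType k Γ] {𝔪 : Ideal Γ}

variable (k) in
theorem exists_sub_algebraMap_mem (h𝔪 : 𝔪.IsMaximal) (γ : Γ) :
    ∃ c : k, γ - algebraMap k Γ c ∈ 𝔪 := by
  let _ : Field (Γ ⧸ 𝔪) := Ideal.Quotient.field 𝔪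
  have : Module.Finite k (Γ ⧸ 𝔪) := finite_of_finite_type_of_isJacobsonRing k (Γ ⧸ 𝔪)
  have : Algebra.IsIntegral k (Γ ⧸ 𝔪) := inferInstance
  obtain ⟨c, hc⟩ := (IsAlgClosed.algebraMap_bijective_of_isIntegral (k := k) (K := Γ ⧸ 𝔪)).2
    (Ideal.Quotient.mk 𝔪 γ)
  exact ⟨c, Ideal.Quotient.eq.1 hc.symm⟩

variable [Ring A] [Algebra k A] {φ : Γ →ₐ[k] A} [AddCommGroup V] [Module A V]

theorem exists_smul_eq_algebraMap_smul (h𝔪 : 𝔪.IsMaximal) {v : V}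
    (hv : ∀ γ ∈ 𝔪, φ γ • v = 0) (γ : Γ) : ∃ c : k, φ γ • v = algebraMap k A c • v := by
  obtain ⟨c, hc⟩ := exists_sub_algebraMap_mem k h𝔪 γ
  exact ⟨c, by rw [← sub_eq_zero, ← sub_smul, ← φ.commutes, ← map_sub, hv _ hc]⟩

theorem mul_map_mem (h𝔪 : 𝔪.IsMaximal) {I : Submodule A A} (hI : ∀ γ ∈ 𝔪, φ γ ∈ I) {x : A}
    (hx : x ∈ I) (γ : Γ) : x * φ γ ∈ I := by
  obtain ⟨c, hc⟩ := exists_sub_algebraMap_mem k h𝔪 γ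
  have hsplit : x * φ γ = x * φ (γ - algebraMap k Γ c) + algebraMap k A c * x := by
    rw [map_sub, φ.commutes, mul_sub, Algebra.commutes, sub_add_cancel]
  exact hsplit ▸ add_mem (I.smul_mem x (hI _ hc)) (I.smul_mem _ hx)

variable [Module k V] [IsScalarTower k A V]

theorem smul_mem_span_of_mem_rightSpan (h𝔪 : 𝔪.IsMaximal) {v : V} (hv : ∀ γ ∈ 𝔪, φ γ • v = 0)
    {s : Set A} {x : A} (hx : x ∈ rightSpan (φ : Γ →+* A).range s) :
    x • v ∈ Submodule.span k ((· • v) '' s) := by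
  have hle : rightSpan (φ : Γ →+* A).range s ≤ (Submodule.span k ((· • v) '' s)).toAddSubgroup.comap
      (LinearMap.toSpanSingleton A V v).toAddMonoidHom := by
    refine (AddSubgroup.closure_le _).2 ?_
    rintro _ ⟨y, hy, _, ⟨γ, rfl⟩, rfl⟩
    obtain ⟨c, hc⟩ := exists_smul_eq_algebraMap_smul h𝔪 hv γ
    change (y * φ γ) • v ∈ Submodule.span k ((· • v) '' s)
    rw [mul_smul, hc, smul_smul, ← Algebra.commutes, ← Algebra.smul_def, smul_assoc]
    exact Submodule.smul_mem _ c (Submodule.subset_span ⟨y, hy, rfl⟩)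
  exact hle hx

theorem exists_isArtinianRing_quotient (h𝔪 : 𝔪.IsMaximal) {v : V} (hv : ∀ γ ∈ 𝔪, φ γ • v = 0)
    {x : A} {s : Set A} (hs : s.Finite) (hx : ∀ γ, φ γ * x ∈ rightSpan (φ : Γ →+* A).range s) :
    ∃ 𝔞 : Ideal Γ, IsArtinianRing (Γ ⧸ 𝔞) ∧ ∀ γ ∈ 𝔞, φ γ • x • v = 0 := by
  let f : Γ →ₗ[k] V :=
    ((LinearMap.toSpanSingleton A V (x • v)).restrictScalars k).comp φ.toLinearMap
  have hf (γ : Γ) : f γ = φ γ • x • v := rfl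
  let 𝔞 : Ideal Γ :=
    { LinearMap.ker f with
      smul_mem' := fun γ δ hδ => by
        change f (γ * δ) = 0
        rw [hf, map_mul, mul_smul, ← hf δ, LinearMap.mem_ker.1 hδ, smul_zero] }
  have hrange : LinearMap.range f ≤ Submodule.span k ((· • v) '' s) := by
    rintro _ ⟨γ, rfl⟩
    rw [hf, smul_smul]
    exact smul_mem_span_of_mem_rightSpan h𝔪 hv (hx γ)
  have : Module.Finite k (Submodule.span k ((· • v) '' s)) :=
    Module.Finite.span_of_finite k (hs.image _)
  have : Module.Finite k (LinearMap.range f) := Submodule.finiteDimensional_of_le hrange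
  have : Module.Finite k (Γ ⧸ 𝔞) := Module.Finite.equiv (f.quotKerEquivRange).symm
  exact ⟨𝔞, IsArtinianRing.of_finite k (Γ ⧸ 𝔞), fun _ hγ => hγ⟩

theorem isGelfandTsetlin_quotient (h𝔪 : 𝔪.IsMaximal) (I : Submodule A A)
    (hI : ∀ γ ∈ 𝔪, φ γ ∈ I)
    (hA : ∀ x : A, ∃ s : Set A, s.Finite ∧ ∀ γ, φ γ * x ∈ rightSpan (φ : Γ →+* A).range s) :
    IsGelfandTsetlin (φ : Γ →+* A) (A ⧸ I) := by
  classical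
  let _ : Module Γ (A ⧸ I) := Module.compHom (A ⧸ I) (φ : Γ →+* A)
  have hone : ∀ γ ∈ 𝔪, φ γ • (Submodule.Quotient.mk 1 : A ⧸ I) = 0 := fun γ hγ =>
    smul_mk_one_eq_zero_iff.2 (hI γ hγ)
  refine ⟨inferInstance, isInternal_powTorsion fun v => ?_⟩
  obtain ⟨x, rfl⟩ := Submodule.Quotient.mk_surjective I v
  obtain ⟨s, hs, hx⟩ := hA x
  obtain ⟨𝔞, h𝔞, h⟩ := exists_isArtinianRing_quotient h𝔪 hone hs hx
  rw [← Submodule.Quotient.mk_smul, smul_eq_mul, mul_one] at h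
  exact ⟨𝔞, h𝔞, h⟩

end Nullstellensatz

section PathOperators

variable {Γ A B : Type*} [CommRing Γ] [Ring A] [Ring B]

/-- The product `x z₀ x z₁ ⋯ x zⱼ₋₁`. -/
def pathOp (φ : Γ →+* A) (x : A) : ℕ → (ℕ → Γ) → A
  | 0, _ => 1
  | j + 1, z => x * (φ (z 0) * pathOp φ x j fun i => z (i + 1))

theorem map_pathOp (ψ : A →+* B) (φ : Γ →+* A) (x : A) (j : ℕ) (z : ℕ → Γ) :
    ψ (pathOp φ x j z) = pathOp (ψ.comp φ) (ψ x) j z := by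
  induction j generalizing z with
  | zero => exact map_one ψ
  | succ j ih => simp only [pathOp, map_mul, ih, RingHom.comp_apply]

theorem pathOp_sub_mem {φ : Γ →+* A} {x : A} {I : Submodule A A}
    (h : ∀ γ, (x - 1) * φ γ ∈ I) (j : ℕ) (z : ℕ → Γ) :
    pathOp φ x j z - φ (∏ i ∈ Finset.range j, z i) ∈ I := by
  induction j generalizing z with
  | zero => simp [pathOp]
  | succ j ih =>
    rw [pathOp, Finset.prod_range_succ', mul_comm _ (z 0)]
    set p := ∏ i ∈ Finset.range j, z (i + 1)
    have hsplit : x * (φ (z 0) * pathOp φ x j fun i => z (i + 1)) - φ (z 0 * p) =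
        x * φ (z 0) * ((pathOp φ x j fun i => z (i + 1)) - φ p) + (x - 1) * φ (z 0 * p) := by
      rw [map_mul]
      noncomm_ring
    exact hsplit ▸ add_mem (I.smul_mem _ (ih _)) (h _)

/-- The additive extension of `z ↦ x z₀ x z₁ ⋯ x zⱼ₋₁` to formal sums of sequences. -/
noncomputable def pathSum (φ : Γ →+* A) (x : A) (j : ℕ) : MonoidAlgebra ℤ (ℕ → Γ) →+ A :=
  MonoidAlgebra.liftNC (Int.castAddHom A) (pathOp φ x j)

theorem map_pathSum (ψ : A →+* B) (φ : Γ →+* A) (x : A) (j : ℕ) (f : MonoidAlgebra ℤ (ℕ → Γ)) :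
    ψ (pathSum φ x j f) = pathSum (ψ.comp φ) (ψ x) j f := by
  refine DFunLike.congr_fun (f := (ψ : A →+ B).comp (pathSum φ x j)) ?_ f
  refine MonoidAlgebra.addMonoidHom_ext fun z c => ?_
  simp [pathSum, map_pathOp]

variable (Γ) in
/-- The ring homomorphism that sends a sequence to the product of its first `j` entries. -/
noncomputable def initialProd (j : ℕ) : MonoidAlgebra ℤ (ℕ → Γ) →+* Γ :=
  MonoidAlgebra.lift ℤ Γ (ℕ → Γ) (∏ i ∈ Finset.range j, Pi.evalMonoidHom (fun _ => Γ) i)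

theorem initialProd_of_mulSingle {i j : ℕ} (hi : i < j) (γ : Γ) :
    initialProd Γ j (MonoidAlgebra.of ℤ _ (Pi.mulSingle i γ)) = γ := by
  change MonoidAlgebra.lift ℤ Γ (ℕ → Γ) _ _ = γ
  rw [MonoidAlgebra.lift_of, MonoidHom.finsetProd_apply]
  exact (Finset.prod_pi_mulSingle' i γ _).trans (if_pos (Finset.mem_range.2 hi))

theorem pathSum_sub_mem {φ : Γ →+* A} {x : A} {I : Submodule A A}
    (h : ∀ γ, (x - 1) * φ γ ∈ I) (j : ℕ) (f : MonoidAlgebra ℤ (ℕ → Γ)) :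
    pathSum φ x j f - φ (initialProd Γ j f) ∈ I := by
  induction f using MonoidAlgebra.induction_linear with
  | zero => simp
  | add f g hf hg =>
    rw [map_add, map_add, map_add, add_sub_add_comm]
    exact add_mem hf hg
  | single z c =>
    have hsplit : pathSum φ x j (MonoidAlgebra.single z c) -
        φ (initialProd Γ j (MonoidAlgebra.single z c)) =
          c • (pathOp φ x j z - φ (∏ i ∈ Finset.range j, z i)) := by
      simp [pathSum, initialProd, mul_sub, MonoidAlgebra.lift_single]
    exact hsplit ▸ zsmul_mem (pathOp_sub_mem h j z) c

theorem mem_of_map_mem {φ : Γ →+* A} {𝔪 : Ideal Γ} (h𝔪 : 𝔪.IsMaximal) {I : Submodule A A}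
    (hI : I ≠ ⊤) (hI𝔪 : ∀ γ ∈ 𝔪, φ γ ∈ I) {γ : Γ} (hγ : φ γ ∈ I) : γ ∈ 𝔪 := by
  by_contra hnot
  obtain ⟨δ, μ, hμ, hδ⟩ := h𝔪.exists_inv hnot
  refine hI ((Ideal.eq_top_iff_one I).2 ?_)
  rw [← map_one φ, ← hδ, map_add, map_mul]
  exact add_mem (I.smul_mem _ hγ) (hI𝔪 _ hμ)

theorem exists_mul_sub_one_mem {I : Submodule A A} (hI : IsCoatom I) {x : A} (hx : x ∉ I) :
    ∃ y : A, y * x - 1 ∈ I := by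
  have htop : I ⊔ Submodule.span A {x} = ⊤ := hI.2 _ (left_lt_sup.2 fun h =>
    hx (h (Submodule.mem_span_singleton_self x)))
  obtain ⟨i, hi, _, hy, hone⟩ := Submodule.mem_sup.1
    (htop ▸ Submodule.mem_top : (1 : A) ∈ I ⊔ Submodule.span A {x})
  obtain ⟨y, rfl⟩ := Submodule.mem_span_singleton.1 hy
  refine ⟨y, ?_⟩
  rw [← hone, ← smul_eq_mul, sub_add_cancel_right]
  exact neg_mem hi

end PathOperators

section Paths

variable {k Γ L : Type*} [Field k] [CommRing Γ] [Field L] [Algebra k L] [Algebra Γ L]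
  {M : Submonoid (L ≃ₐ[k] L)}

/-- The value `t₁(z₀ t₂(z₁ ⋯ tⱼ(zⱼ₋₁)))` of a sequence `z` along the word `t₁ t₂ ⋯ tⱼ`. -/
def pathVal : List M → (ℕ → Γ) →* L
  | [] => 1
  | t :: w => ((t : L ≃ₐ[k] L) : L →* L).comp
      ((algebraMap Γ L : Γ →* L).comp (Pi.evalMonoidHom (fun _ => Γ) 0) *
        (pathVal w).comp (MonoidHom.pi fun i => Pi.evalMonoidHom (fun _ => Γ) (i + 1)))

theorem pathVal_cons (t : M) (w : List M) (z : ℕ → Γ) :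
    pathVal (t :: w) z =
      (t : L ≃ₐ[k] L) (algebraMap Γ L (z 0) * pathVal w fun i => z (i + 1)) := rfl

theorem pathVal_mulSingle (w : List M) {i : ℕ} (hi : i < w.length) (γ : Γ) :
    pathVal (k := k) w (Pi.mulSingle i γ : ℕ → Γ) =
      ((w.take (i + 1)).prod : L ≃ₐ[k] L) (algebraMap Γ L γ) := by
  induction w generalizing i with
  | nil => exact absurd hi (Nat.not_lt_zero i)
  | cons t w ih =>
    rw [pathVal_cons]
    rcases i with _ | i
    · have hshift : (fun j => (Pi.mulSingle 0 γ : ℕ → Γ) (j + 1)) = 1 := by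
        funext j
        simp
      rw [hshift, map_one]
      simp
    · have hshift : (fun j => (Pi.mulSingle (i + 1) γ : ℕ → Γ) (j + 1)) = Pi.mulSingle i γ := by
        funext j
        simp [Pi.mulSingle_apply]
      rw [hshift, ih (Nat.lt_of_succ_lt_succ hi)]
      simp

theorem exists_pathOp_eq_sum (x : SkewMonoidAlgebra L M) (j : ℕ) :
    ∃ (W : Finset (List M)) (c : List M → L),
      (∀ w ∈ W, w.length = j ∧ ∀ t ∈ w, t ∈ x.support) ∧
        ∀ z : ℕ → Γ, pathOp (coeffHom Γ M) x j z = ∑ w ∈ W, single w.prod (c w * pathVal w z) := by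
  induction j with
  | zero => exact ⟨{[]}, 1, by simp, fun z => by
      rw [Finset.sum_singleton, pathOp, one_def]
      simp [pathVal]⟩
  | succ j ih =>
    obtain ⟨W, c, hW, hc⟩ := ih
    refine ⟨(x.support ×ˢ W).map ⟨fun p => p.1 :: p.2, fun p q h => by
      simpa [Prod.ext_iff] using h⟩, fun w => match w with
        | [] => 0
        | t :: w => x.coeff t * (t : L ≃ₐ[k] L) (c w), ?_, fun z => ?_⟩
    · simp only [Finset.mem_map, Finset.mem_product]
      rintro _ ⟨⟨t, w⟩, ⟨ht, hw⟩, rfl⟩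
      exact ⟨congrArg Nat.succ (hW w hw).1, List.forall_mem_cons.2 ⟨ht, (hW w hw).2⟩⟩
    · have hx : x = ∑ t ∈ x.support, single t (x.coeff t) := by
        conv_lhs => rw [← sum_single x]
        rw [sum_def']
      rw [pathOp, hc, Finset.sum_map, Finset.sum_product]
      conv_lhs => enter [1]; rw [hx]
      rw [Finset.sum_mul]
      refine Finset.sum_congr rfl fun t _ => ?_
      rw [Finset.mul_sum, Finset.mul_sum]
      refine Finset.sum_congr rfl fun w _ => ?_
      rw [coeffHom_apply, single_mul_single, single_mul_single, one_mul, one_smul]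
      refine congrArg₂ single List.prod_cons.symm ?_
      change x.coeff t * (t : L ≃ₐ[k] L) _ = x.coeff t * (t : L ≃ₐ[k] L) (c w) * pathVal (t :: w) z
      rw [pathVal_cons, mul_assoc, ← map_mul, mul_left_comm]

variable (Γ) in
/-- The linear extension of `pathVal w` to formal sums of sequences. -/
noncomputable def pathEval (w : List M) : MonoidAlgebra ℤ (ℕ → Γ) →+* L :=
  MonoidAlgebra.lift ℤ L (ℕ → Γ) (pathVal w)

theorem exists_ker_pathEval_le {x : SkewMonoidAlgebra L M} {j : ℕ}
    {Q : Ideal (MonoidAlgebra ℤ (ℕ → Γ))} (hQ : Q.IsPrime)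
    (h : ∀ f, pathSum (coeffHom Γ M) x j f = 0 → f ∈ Q) :
    ∃ w : List M, w.length = j ∧ (∀ t ∈ w, t ∈ x.support) ∧ RingHom.ker (pathEval Γ w) ≤ Q := by
  obtain ⟨W, c, hW, hc⟩ := exists_pathOp_eq_sum (Γ := Γ) x j
  have hsum (f) : pathSum (coeffHom Γ M) x j f = ∑ w ∈ W, single w.prod (c w * pathEval Γ w f) := by
    induction f using MonoidAlgebra.induction_linear with
    | zero => simp
    | add f g hf hg =>
      simp only [map_add, mul_add, single_add, Finset.sum_add_distrib, hf, hg]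
    | single z n =>
      have hz : pathSum (coeffHom Γ M) x j (MonoidAlgebra.single z n) =
          n • pathOp (coeffHom Γ M) x j z := by
        simp [pathSum]
      have hw (w : List M) : pathEval Γ w (MonoidAlgebra.single z n) = n • pathVal w z := by
        simp [pathEval, MonoidAlgebra.lift_single]
      simp only [hz, hw, hc, ← Finset.sum_zsmul, mul_smul_comm]
      exact Finset.sum_congr rfl fun w _ => (map_zsmul (singleAddHom (k := L) w.prod) n _).symm
  have hle : W.inf (fun w => RingHom.ker (pathEval Γ w)) ≤ Q := fun f hf => by
    refine h f ((hsum f).trans (Finset.sum_eq_zero fun w hw => ?_))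
    rw [RingHom.mem_ker.1 (Finset.inf_le (f := fun w => RingHom.ker (pathEval Γ w)) hw hf),
      mul_zero, single_zero]
  obtain ⟨w, hw, hker⟩ := (Ideal.IsPrime.inf_le' hQ).1 hle
  exact ⟨w, (hW w hw).1, (hW w hw).2, hker⟩

theorem symm_pathVal_mem (hM : M ≤ pullbackMonoid Γ k L) (w : List M) (z : ℕ → Γ) :
    (w.prod : L ≃ₐ[k] L).symm (pathVal w z) ∈ integralClosure Γ L := by
  induction w generalizing z with
  | nil => simp [pathVal]
  | cons t w ih =>
    rw [List.prod_cons, pathVal_cons]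
    change (w.prod : L ≃ₐ[k] L).symm ((t : L ≃ₐ[k] L).symm ((t : L ≃ₐ[k] L) _)) ∈ _
    rw [AlgEquiv.symm_apply_apply, map_mul]
    exact mul_mem (hM w.prod.2 _ (algebraMap_mem _ _)) (ih _)

theorem symm_pathVal_mulSingle (w : List M) {i : ℕ} (hi : i < w.length) (γ : Γ) :
    (w.prod : L ≃ₐ[k] L).symm (pathVal w (Pi.mulSingle i γ)) =
      ((w.drop (i + 1)).prod : L ≃ₐ[k] L).symm (algebraMap Γ L γ) := by
  have hprod : w.prod = (w.take (i + 1)).prod * (w.drop (i + 1)).prod := by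
    rw [← List.prod_append, List.take_append_drop]
  rw [pathVal_mulSingle w hi, hprod]
  exact congrArg _ (AlgEquiv.symm_apply_apply _ _)

theorem pathEval_of (w : List M) (z : ℕ → Γ) :
    pathEval Γ w (MonoidAlgebra.of ℤ _ z) = pathVal w z :=
  MonoidAlgebra.lift_of _ _

theorem symm_pathEval_mem (hM : M ≤ pullbackMonoid Γ k L) (w : List M)
    (f : MonoidAlgebra ℤ (ℕ → Γ)) :
    (w.prod : L ≃ₐ[k] L).symm (pathEval Γ w f) ∈ integralClosure Γ L := by
  induction f using MonoidAlgebra.induction_on with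
  | of z => exact pathEval_of w z ▸ symm_pathVal_mem hM w z
  | add f g hf hg =>
    rw [map_add, map_add]
    exact add_mem hf hg
  | smul c f hf =>
    rw [map_zsmul, map_zsmul]
    exact zsmul_mem hf c

theorem exists_forall_smul_mem_pointsOver (hM : M ≤ pullbackMonoid Γ k L) {𝔪 : Ideal Γ}
    (h𝔪 : 𝔪.IsMaximal) {w : List M} (hw : w ≠ [])
    (hker : RingHom.ker (pathEval Γ w) ≤ 𝔪.comap (initialProd Γ w.length)) :
    ∃ ℓ : Ideal (integralClosure Γ L), ∀ i < w.length,
      Submonoid.inclusion hM (w.drop (i + 1)).prod • ℓ ∈ pointsOver L 𝔪 := by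
  let e : MonoidAlgebra ℤ (ℕ → Γ) →+* integralClosure Γ L :=
    (((w.prod : L ≃ₐ[k] L).symm : L →+* L).comp (pathEval Γ w)).codRestrict _
      (symm_pathEval_mem hM w)
  have he {i : ℕ} (hi : i < w.length) (γ : Γ) :
      pullbackHom (Submonoid.inclusion hM (w.drop (i + 1)).prod) (algebraMap Γ _ γ) =
        e (MonoidAlgebra.of ℤ _ (Pi.mulSingle i γ)) :=
    Subtype.ext (((symm_pathVal_mulSingle w hi γ).symm).trans
      (congrArg (w.prod : L ≃ₐ[k] L).symm (pathEval_of w _).symm))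
  have hΓ (γ : Γ) : algebraMap Γ (integralClosure Γ L) γ ∈ e.range := by
    refine ⟨_, (he (Nat.sub_one_lt (List.length_eq_zero_iff.not.2 hw)) γ).symm.trans ?_⟩
    rw [Nat.sub_add_cancel (List.length_pos_iff.2 hw), List.drop_length]
    rfl
  have hprime : (𝔪.comap (initialProd Γ w.length)).IsPrime :=
    have := h𝔪.isPrime
    Ideal.IsPrime.comap _
  obtain ⟨ℓ, hℓ, hmem⟩ := exists_isPrime_of_ker_le e hΓ _ fun f hf =>
    hker ((w.prod : L ≃ₐ[k] L).symm.injective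
      ((congrArg Subtype.val (RingHom.mem_ker.1 hf)).trans (map_zero _).symm))
  refine ⟨ℓ, fun i hi => mem_pointsOver h𝔪 (isPrime_smul _ hℓ) fun γ hγ => ?_⟩
  rw [mem_smul_ideal, he hi, hmem, Ideal.mem_comap, initialProd_of_mulSingle hi]
  exact hγ

end Paths

section Pigeonhole

variable {E X : Type*} [Monoid E] [MulAction E X]

theorem exists_mul_smul_eq_of_ncard_lt {Y : Set X} (hY : Y.Finite) {w : List E}
    (hw : Y.ncard < w.length) {x : X} (h : ∀ i < w.length, (w.drop (i + 1)).prod • x ∈ Y) :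
    ∃ t ∈ w, ∃ p, ∃ y ∈ Y, (t * p) • y = y := by
  obtain ⟨i, hi, j, hj, hne, heq⟩ := Set.exists_ne_map_eq_of_ncard_lt_of_maps_to
    (s := Set.Iio w.length) (by simpa using hw) (f := fun i => (w.drop (i + 1)).prod • x) h hY
  wlog hlt : i < j generalizing i j
  · exact this j hj i hi hne.symm heq.symm (by omega)
  obtain ⟨d, rfl⟩ := Nat.exists_eq_add_of_lt hlt
  have hi' : i + 1 < w.length := lt_of_le_of_lt (by omega) (Set.mem_Iio.1 hj)
  refine ⟨w[i + 1], List.getElem_mem hi', ((w.drop (i + 2)).take d).prod, _, h _ hj, ?_⟩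
  rw [← mul_smul, mul_assoc, ← heq]
  congr 1
  rw [List.drop_eq_getElem_cons hi', List.prod_cons]
  conv_rhs => rw [← List.take_append_drop d (w.drop (i + 1 + 1)), List.prod_append, List.drop_drop]
  congr 4
  omega

end Pigeonhole

section NonInvertibleSupport

variable {k Γ K L : Type*} [Field k] [CommRing Γ] [Field L] [Algebra k L] [Algebra Γ L]
  {M : Submonoid (L ≃ₐ[k] L)} {𝔪 : Ideal Γ}

theorem exists_inv_mem_of_ker_pathEval_le [Module.Finite Γ (integralClosure Γ L)]
    (hM : M ≤ pullbackMonoid Γ k L) (h𝔪 : 𝔪.IsMaximal)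
    (hfin : ∀ ℓ ∈ pointsOver L 𝔪, (stabilizerIn hM ℓ : Set M).Finite) {w : List M}
    (hw : (pointsOver L 𝔪).ncard < w.length)
    (hker : RingHom.ker (pathEval Γ w) ≤ 𝔪.comap (initialProd Γ w.length)) :
    ∃ t ∈ w, (t : L ≃ₐ[k] L)⁻¹ ∈ M := by
  obtain ⟨ℓ, hℓ⟩ := exists_forall_smul_mem_pointsOver hM h𝔪
    (List.length_pos_iff.1 (Nat.zero_lt_of_lt hw)) hker
  let _ : MulAction M (Ideal (integralClosure Γ L)) :=
    MulAction.compHom _ (Submonoid.inclusion hM)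
  obtain ⟨t, ht, p, y, hy, hfix⟩ := exists_mul_smul_eq_of_ncard_lt (finite_pointsOver 𝔪) hw hℓ
  exact ⟨t, ht, left_inv_mem_of_mul p.2 (inv_mem_of_mem_finite (hfin y hy) (a := t * p) hfix)⟩

variable [Algebra k Γ] [IsScalarTower k Γ L] [Field K] [Algebra k K] [Algebra K L]
  [IsScalarTower k K L] {hconj : IsConjClosed K M} {U : Subring (SkewMonoidAlgebra L M)}

theorem IsGaloisRing.incl_algebraMap_mul_comm (hU : IsGaloisRing Γ hconj U) (c : k) (u : U) :
    hU.incl (algebraMap k Γ c) * u = u * hU.incl (algebraMap k Γ c) := by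
  ext t
  change (coeffHom Γ M (algebraMap k Γ c) * (u : SkewMonoidAlgebra L M)).coeff t =
    ((u : SkewMonoidAlgebra L M) * coeffHom Γ M (algebraMap k Γ c)).coeff t
  rw [coeffHom_apply, coeff_mul_single_one_eq, coeff_single_one_mul,
    ← IsScalarTower.algebraMap_apply, AlgEquiv.commutes, mul_comm]

/-- The structure of a `k`-algebra on a Galois ring over the `k`-algebra `Γ`. -/
noncomputable abbrev IsGaloisRing.algebra (hU : IsGaloisRing Γ hconj U) : Algebra k U :=
  (hU.incl.comp (algebraMap k Γ)).toAlgebra' hU.incl_algebraMap_mul_comm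

/-- The inclusion of `Γ` as a homomorphism of `k`-algebras. -/
noncomputable def IsGaloisRing.inclAlgHom (hU : IsGaloisRing Γ hconj U) :
    letI := hU.algebra
    Γ →ₐ[k] U :=
  letI := hU.algebra
  { hU.incl with commutes' := fun _ => rfl }

theorem IsGaloisRing.mem_of_forall_inv_notMem [IsAlgClosed k] [Algebra.FiniteType k Γ]
    [Module.Finite Γ (integralClosure Γ L)] (hU : IsGaloisRing Γ hconj U)
    (hM : M ≤ pullbackMonoid Γ k L) (h𝔪 : 𝔪.IsMaximal)
    (hfin : ∀ ℓ ∈ pointsOver L 𝔪, (stabilizerIn hM ℓ : Set M).Finite)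
    {I : Submodule U U} (hI : IsCoatom I) (hI𝔪 : ∀ γ ∈ 𝔪, hU.incl γ ∈ I) {x : U}
    (hx : ∀ t ∈ (x : SkewMonoidAlgebra L M).support, (t : L ≃ₐ[k] L)⁻¹ ∉ M) : x ∈ I := by
  classical
  by_contra hxI
  obtain ⟨y, hy⟩ := exists_mul_sub_one_mem hI hxI
  let _ := hU.algebra
  have hyγ (γ : Γ) : (y * x - 1) * hU.incl γ ∈ I :=
    mul_map_mem (φ := hU.inclAlgHom) h𝔪 hI𝔪 hy γ
  let j := (pointsOver L 𝔪).ncard + 1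
  have hprime : (𝔪.comap (initialProd Γ j)).IsPrime :=
    have := h𝔪.isPrime
    Ideal.IsPrime.comap _
  obtain ⟨w, hw, hsupp, hker⟩ := exists_ker_pathEval_le (x := ((y * x : U) : SkewMonoidAlgebra L M))
    hprime fun f hf => by
      have hzero : pathSum hU.incl (y * x) j f = 0 :=
        Subtype.ext ((map_pathSum U.subtype hU.incl _ _ f).trans hf)
      have hmem := pathSum_sub_mem hyγ j f
      rw [hzero, zero_sub, neg_mem_iff] at hmem
      exact mem_of_map_mem h𝔪 hI.1 hI𝔪 hmem
  obtain ⟨t, ht, htM⟩ := exists_inv_mem_of_ker_pathEval_le hM h𝔪 hfin (w := w)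
    (hw ▸ Nat.lt_succ_self _) (hw ▸ hker)
  obtain ⟨a, -, b, hb, rfl⟩ := Finset.mem_mul.1 (support_mul _ _ (hsupp t ht))
  exact hx b hb (right_inv_mem_of_mul a.2 htM)

end NonInvertibleSupport

section Density

variable {A N S T ι : Type*} [Ring A] [AddCommGroup N] [Module A N] [AddCommGroup S] [Module A S]
  [AddCommGroup T] [Module A T]

theorem nonempty_equiv_of_ker_le [IsSimpleModule A S] [Nontrivial T] {f : N →ₗ[A] S}
    {g : N →ₗ[A] T} (hf : Function.Surjective f) (hg : Function.Surjective g)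
    (h : LinearMap.ker f ≤ LinearMap.ker g) : Nonempty (S ≃ₗ[A] T) := by
  have hcoatom : IsCoatom (LinearMap.ker f) := isSimpleModule_iff_isCoatom.1
    (IsSimpleModule.congr (f.quotKerEquivOfSurjective hf))
  have hne : LinearMap.ker g ≠ ⊤ := fun htop => by
    obtain ⟨y, hy⟩ := exists_ne (0 : T)
    obtain ⟨x, rfl⟩ := hg y
    exact hy (LinearMap.mem_ker.1 (htop ▸ Submodule.mem_top))
  have hker : LinearMap.ker f = LinearMap.ker g :=
    ((hcoatom.le_iff.1 h).resolve_left hne).symm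
  exact ⟨(f.quotKerEquivOfSurjective hf).symm.trans
    ((Submodule.quotEquivOfEq _ _ hker).trans (g.quotKerEquivOfSurjective hg))⟩

theorem surjective_mkQ_comp_subtype {P Q : Submodule A A} (hQ : IsCoatom Q) (h : ¬ P ≤ Q) :
    Function.Surjective (Q.mkQ ∘ₗ P.subtype) := by
  have := isSimpleModule_iff_isCoatom.2 hQ
  refine (LinearMap.surjective_or_eq_zero _).resolve_right fun hzero => h fun x hx => ?_
  exact (Submodule.Quotient.mk_eq_zero Q).1 (LinearMap.congr_fun hzero ⟨x, hx⟩)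

variable {I : ι → Submodule A A}

theorem not_inf_le_of_pairwise (hI : ∀ i, IsCoatom (I i))
    (hne : Pairwise fun i j => IsEmpty ((A ⧸ I i) ≃ₗ[A] (A ⧸ I j))) (s : Finset ι) {i : ι}
    (hi : i ∉ s) : ¬ s.inf I ≤ I i := by
  classical
  induction s using Finset.induction_on generalizing i with
  | empty => exact fun h => (hI i).1 (top_le_iff.1 h)
  | insert a s ha ih =>
    rw [Finset.mem_insert, not_or] at hi
    rw [Finset.inf_insert]
    intro hle
    have := isSimpleModule_iff_isCoatom.2 (hI a)
    have : Nontrivial (A ⧸ I i) := Submodule.Quotient.nontrivial_iff.2 (hI i).1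
    obtain ⟨e⟩ := nonempty_equiv_of_ker_le (surjective_mkQ_comp_subtype (hI a) (ih ha))
      (surjective_mkQ_comp_subtype (hI i) (ih hi.2)) fun x hx =>
        (Submodule.Quotient.mk_eq_zero _).2 (hle ⟨(Submodule.Quotient.mk_eq_zero _).1 hx, x.2⟩)
    exact (hne (Ne.symm hi.1)).false e

theorem exists_sub_one_mem_of_pairwise [Finite ι] (hI : ∀ i, IsCoatom (I i))
    (hne : Pairwise fun i j => IsEmpty ((A ⧸ I i) ≃ₗ[A] (A ⧸ I j))) (i : ι) :
    ∃ x : A, x - 1 ∈ I i ∧ ∀ j ≠ i, x ∈ I j := by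
  classical
  have := Fintype.ofFinite ι
  let J := (Finset.univ.erase i).inf I
  have htop : I i ⊔ J = ⊤ := (hI i).2 _ (left_lt_sup.2
    (not_inf_le_of_pairwise hI hne _ (Finset.notMem_erase i _)))
  obtain ⟨a, ha, x, hx, hax⟩ := Submodule.mem_sup.1 (htop ▸ Submodule.mem_top : (1 : A) ∈ I i ⊔ J)
  refine ⟨x, ?_, fun j hj => ?_⟩
  · rw [← hax, sub_add_cancel_right]
    exact neg_mem ha
  · exact Finset.inf_le (f := I) (Finset.mem_erase.2 ⟨hj, Finset.mem_univ j⟩) hx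

variable {k : Type*} [Field k] [Algebra k A]

theorem natCard_le_finrank [Finite ι] (hI : ∀ i, IsCoatom (I i))
    (hne : Pairwise fun i j => IsEmpty ((A ⧸ I i) ≃ₗ[A] (A ⧸ I j))) (E : Submodule k A)
    [Module.Finite k E]
    (hE : ∀ x : A, ∃ e ∈ E, ∀ i, ∀ c : k, x - algebraMap k A c ∈ I i → x - e ∈ I i) :
    Nat.card ι ≤ Module.finrank k E := by
  classical
  have := Fintype.ofFinite ι
  choose x hx hx' using exists_sub_one_mem_of_pairwise hI hne
  choose e he hxe using hE
  have hone (i) : (I i).mkQ (e (x i)) = (I i).mkQ 1 := by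
    have h : x i - e (x i) ∈ I i := hxe (x i) i 1 ((map_one (algebraMap k A)).symm ▸ hx i)
    exact ((Submodule.Quotient.eq _).2 h).symm.trans ((Submodule.Quotient.eq _).2 (hx i))
  have hzero {i j} (h : j ≠ i) : (I j).mkQ (e (x i)) = 0 := by
    have hxj : x i - algebraMap k A 0 ∈ I j := by simpa using hx' i j h
    have hmem := sub_mem (hx' i j h) (hxe (x i) j 0 hxj)
    rw [sub_sub_cancel] at hmem
    exact (Submodule.Quotient.mk_eq_zero _).2 hmem
  have hind : LinearIndependent k fun i => (⟨e (x i), he _⟩ : E) := by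
    refine Fintype.linearIndependent_iff.2 fun c hc i => ?_
    have hsum : ∑ j, c j • e (x j) = 0 := by
      simpa using congrArg Subtype.val hc
    have hmk := congrArg ((I i).mkQ.restrictScalars k) hsum
    rw [_root_.map_sum, Finset.sum_eq_single i, map_smul, map_zero, LinearMap.restrictScalars_apply,
      hone] at hmk
    · refine (smul_eq_zero.1 hmk).resolve_right fun h => (hI i).1 ?_
      exact (Ideal.eq_top_iff_one _).2 ((Submodule.Quotient.mk_eq_zero _).1 h)
    · intro j _ hji
      rw [map_smul, LinearMap.restrictScalars_apply, hzero hji.symm, smul_zero]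
    · exact fun h => absurd (Finset.mem_univ i) h
  exact Nat.card_eq_fintype_card.trans_le hind.fintype_card_le_finrank

theorem finite_fiber {Γ : Type*} [CommRing Γ] {φ : Γ →+* A} {𝔪 : Ideal Γ} (E : Submodule k A)
    [Module.Finite k E]
    (hE : ∀ x : A, ∃ e ∈ E, ∀ I : Submodule A A, IsCoatom I → (∀ γ ∈ 𝔪, φ γ ∈ I) →
      ∀ c : k, x - algebraMap k A c ∈ I → x - e ∈ I) :
    Finite (Fiber φ 𝔪) := by
  by_contra hinf
  rw [not_finite_iff_infinite] at hinf
  let f : Fin (Module.finrank k E + 1) ↪ Fiber φ 𝔪 :=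
    Fin.valEmbedding.trans (Infinite.natEmbedding (Fiber φ 𝔪))
  have hne : Pairwise fun i j =>
      IsEmpty ((A ⧸ (f i).out.1) ≃ₗ[A] (A ⧸ (f j).out.1)) := fun i j hij => ⟨fun e =>
    hij (f.injective (((f i).out_eq.symm.trans (Quotient.sound ⟨e⟩)).trans (f j).out_eq))⟩
  have hle := natCard_le_finrank (fun i => (f i).out.2.1) hne E fun x => by
    obtain ⟨e, he, h⟩ := hE x
    exact ⟨e, he, fun i => h _ (f i).out.2.1 (f i).out.2.2⟩
  rw [Nat.card_fin] at hle
  exact Nat.not_succ_le_self _ hle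

end Density

section UnitPart

variable {k L : Type*} [Field k] [Field L] [Algebra k L] {M : Submonoid (L ≃ₐ[k] L)}

open Classical in
/-- The part of an element of `L * M` that is supported at the invertible elements of `M`. -/
noncomputable def unitPart : SkewMonoidAlgebra L M →+ SkewMonoidAlgebra L M :=
  scale fun t => if (t : L ≃ₐ[k] L)⁻¹ ∈ M then 1 else 0

theorem coeff_unitPart_of_inv_mem {t : M} (ht : (t : L ≃ₐ[k] L)⁻¹ ∈ M)
    (w : SkewMonoidAlgebra L M) : (unitPart w).coeff t = w.coeff t :=
  (coeff_scale _ w t).trans (by rw [if_pos ht, one_mul])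

theorem coeff_unitPart_of_inv_notMem {t : M} (ht : (t : L ≃ₐ[k] L)⁻¹ ∉ M)
    (w : SkewMonoidAlgebra L M) : (unitPart w).coeff t = 0 :=
  (coeff_scale _ w t).trans (by rw [if_neg ht, zero_mul])

theorem unitPart_mul_single_one (w : SkewMonoidAlgebra L M) (y : L) :
    unitPart (w * single 1 y) = unitPart w * single 1 y :=
  scale_mul_single_one _ _ _

theorem inv_notMem_of_unitPart_eq_zero {w : SkewMonoidAlgebra L M} (hw : unitPart w = 0) {t : M}
    (ht : t ∈ w.support) : (t : L ≃ₐ[k] L)⁻¹ ∉ M := fun hinv => by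
  rw [mem_support_iff, ← coeff_unitPart_of_inv_mem hinv, hw] at ht
  exact ht rfl

theorem unitPart_eq_of_forall {v w : SkewMonoidAlgebra L M}
    (h : ∀ t : M, (t : L ≃ₐ[k] L)⁻¹ ∈ M → v.coeff t = w.coeff t)
    (hw : w ∈ supportedIn {t : M | (t : L ≃ₐ[k] L)⁻¹ ∈ M}) : unitPart v = w := by
  ext t
  by_cases ht : (t : L ≃ₐ[k] L)⁻¹ ∈ M
  · rw [coeff_unitPart_of_inv_mem ht, h t ht]
  · rw [coeff_unitPart_of_inv_notMem ht, hw t ht]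

end UnitPart

section RightSpanLift

theorem map_rightSpan_range {Γ R R' : Type*} [Ring Γ] [Ring R] [Ring R'] {φ : Γ →+* R}
    {ψ : Γ →+* R'} {f : R →+ R'} (hf : ∀ x γ, f (x * φ γ) = f x * ψ γ) (s : Set R) :
    (rightSpan φ.range s).map f = rightSpan ψ.range (f '' s) := by
  rw [rightSpan, rightSpan, AddMonoidHom.map_closure]
  congr 1
  ext w
  constructor
  · rintro ⟨_, ⟨y, hy, _, ⟨γ, rfl⟩, rfl⟩, rfl⟩
    exact ⟨f y, ⟨y, hy, rfl⟩, _, ⟨γ, rfl⟩, hf y γ⟩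
  · rintro ⟨_, ⟨y, hy, rfl⟩, _, ⟨γ, rfl⟩, rfl⟩
    exact ⟨_, ⟨y, hy, _, ⟨γ, rfl⟩, rfl⟩, hf y γ⟩

variable {k Γ K L : Type*} [Field k] [CommRing Γ] [Field K] [Algebra k K] [Field L] [Algebra k L]
  [Algebra Γ L] [Algebra K L] [IsScalarTower k K L] {M : Submonoid (L ≃ₐ[k] L)}
  {hconj : IsConjClosed K M} {U : Subring (SkewMonoidAlgebra L M)}

theorem IsGaloisRing.exists_finite_rightSpan [IsNoetherianRing Γ] (hU : IsGaloisRing Γ hconj U)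
    {f : U →+ SkewMonoidAlgebra L M} (hf : ∀ u γ, f (u * hU.incl γ) = f u * coeffHom Γ M γ)
    {W : AddSubgroup (SkewMonoidAlgebra L M)}
    (hW : (Submodule.span Γ (rightCoeff '' (W : Set (SkewMonoidAlgebra L M)))).FG) :
    ∃ s : Set U, s.Finite ∧ ∀ u, f u ∈ W → ∃ x ∈ rightSpan hU.incl.range s, f x = f u := by
  classical
  have hWf : (Submodule.span Γ (rightCoeff ''
      ((W ⊓ f.range : AddSubgroup (SkewMonoidAlgebra L M)) : Set (SkewMonoidAlgebra L M)))).FG :=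
    hW.of_le (Submodule.span_mono (Set.image_mono fun _ hw => hw.1))
  obtain ⟨t, ht, hle⟩ := exists_finset_le_rightSpan hWf
  obtain ⟨s, -, rfl⟩ := Finset.subset_set_image_iff.1
    (show (t : Set (SkewMonoidAlgebra L M)) ⊆ f '' Set.univ from
      fun w hw => (ht hw).2.imp fun _ h => ⟨trivial, h⟩)
  refine ⟨s, s.finite_toSet, fun u hu => ?_⟩
  have hmem := hle (AddSubgroup.mem_inf.2 ⟨hu, u, rfl⟩)
  rw [Finset.coe_image, coeffRing, ← map_rightSpan_range hf] at hmem
  exact hmem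

theorem IsRightOrder.exists_finite_forall_incl_mul_mem_rightSpan [IsNoetherianRing Γ]
    [FiniteDimensional K L] (hR : IsRightOrder Γ hconj U) (hU : IsGaloisRing Γ hconj U) (u : U) :
    ∃ s : Set U, s.Finite ∧ ∀ γ, hU.incl γ * u ∈ rightSpan hU.incl.range s := by
  let S : Set M := ((u : SkewMonoidAlgebra L M).support : Set M)
  obtain ⟨s, hs, h⟩ := hU.exists_finite_rightSpan (f := U.subtype.toAddMonoidHom)
    (fun _ _ => rfl) (hR.fg_span_rightCoeff hU (S := S) (Finset.finite_toSet _))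
  refine ⟨s, hs, fun γ => ?_⟩
  obtain ⟨x, hx, hxu⟩ := h (hU.incl γ * u) (AddSubgroup.mem_inf.2
    ⟨(hU.incl γ * u).2, single_mul_mem_supportedIn _ (mem_supportedIn_support _)⟩)
  have hxu' : x = hU.incl γ * u := Subtype.coe_injective hxu
  exact hxu' ▸ hx

end RightSpanLift

section Approximation

variable {k Γ K L : Type*} [Field k] [CommRing Γ]
  [Field K] [Algebra Γ K] [Field L] [Algebra k L] [Algebra Γ L] [Algebra K L]
  [IsScalarTower Γ K L]
  {M : Submonoid (L ≃ₐ[k] L)} {hM : M ≤ pullbackMonoid Γ k L} {𝔪 : Ideal Γ}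

variable (Γ M) in
/-- The ideal generated by the constant functions and by the functions `t ↦ t(y)` that come from
elements of `𝔪`. It describes multiplication by `𝔪` from the left and from the right. -/
def pairIdeal (𝔪 : Ideal Γ) : Ideal (pairRing M (algebraMap Γ L).range) :=
  𝔪.map ((leftPair M _).comp (algebraMap Γ L).rangeRestrict) ⊔
    𝔪.map ((rightPair M _).comp (algebraMap Γ L).rangeRestrict)

theorem leftPair_mem_pairIdeal {γ : Γ} (hγ : γ ∈ 𝔪) :
    leftPair M _ ((algebraMap Γ L).rangeRestrict γ) ∈ pairIdeal Γ M 𝔪 :=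
  Ideal.mem_sup_left (Ideal.mem_map_of_mem
    ((leftPair M _).comp (algebraMap Γ L).rangeRestrict) hγ)

theorem rightPair_mem_pairIdeal {γ : Γ} (hγ : γ ∈ 𝔪) :
    rightPair M _ ((algebraMap Γ L).rangeRestrict γ) ∈ pairIdeal Γ M 𝔪 :=
  Ideal.mem_sup_right (Ideal.mem_map_of_mem
    ((rightPair M _).comp (algebraMap Γ L).rangeRestrict) hγ)

variable (Γ K L) in
theorem range_algebraMap_le_baseClosure :
    (algebraMap Γ L).range ≤ (baseClosure Γ K L).toSubring := by
  rintro _ ⟨γ, rfl⟩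
  exact (baseClosure Γ K L).algebraMap_mem γ

variable (Γ K) in
/-- The extension of the ring of functions built from `Γ` to the one built from `baseClosure`. -/
def inclPairRing (M : Submonoid (L ≃ₐ[k] L)) :
    pairRing M (algebraMap Γ L).range →+* pairRing M (baseClosure Γ K L).toSubring :=
  Subring.inclusion (pairRing_mono (range_algebraMap_le_baseClosure Γ K L))

theorem isIntegral_inclPairRing : (inclPairRing Γ K M).IsIntegral := by
  refine isIntegral_inclusion_pairRing (range_algebraMap_le_baseClosure Γ K L) fun x => ?_
  obtain ⟨p, hp, hx⟩ := baseClosure_le x.2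
  refine ⟨p.map (algebraMap Γ L).rangeRestrict, hp.map _, Subtype.ext ?_⟩
  rw [Polynomial.eval₂_map]
  exact (Polynomial.hom_eval₂ p _ (baseClosure Γ K L).toSubring.subtype x).trans hx

theorem coe_inclPairRing (a : pairRing M (algebraMap Γ L).range) :
    (inclPairRing Γ K M a : M → L) = a :=
  Subring.coe_inclusion _ a

theorem inclPairRing_leftPair (γ : Γ) :
    inclPairRing Γ K M (leftPair M _ ((algebraMap Γ L).rangeRestrict γ)) =
      leftPair M _ (algebraMap Γ (baseClosure Γ K L) γ) :=
  inclusion_leftPair (range_algebraMap_le_baseClosure Γ K L) _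

theorem inclPairRing_rightPair (γ : Γ) :
    inclPairRing Γ K M (rightPair M _ ((algebraMap Γ L).rangeRestrict γ)) =
      rightPair M _ (algebraMap Γ (baseClosure Γ K L) γ) :=
  inclusion_rightPair (range_algebraMap_le_baseClosure Γ K L) _

theorem leftPair_algebraMap_mem {Q : Ideal (pairRing M (baseClosure Γ K L).toSubring)}
    (hQ : pairIdeal Γ M 𝔪 ≤ Q.comap (inclPairRing Γ K M)) {γ : Γ} (hγ : γ ∈ 𝔪) :
    leftPair M _ (algebraMap Γ (baseClosure Γ K L) γ) ∈ Q := by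
  rw [← inclPairRing_leftPair]
  exact Ideal.mem_comap.1 (hQ (leftPair_mem_pairIdeal hγ))

theorem rightPair_algebraMap_mem {Q : Ideal (pairRing M (baseClosure Γ K L).toSubring)}
    (hQ : pairIdeal Γ M 𝔪 ≤ Q.comap (inclPairRing Γ K M)) {γ : Γ} (hγ : γ ∈ 𝔪) :
    rightPair M _ (algebraMap Γ (baseClosure Γ K L) γ) ∈ Q := by
  rw [← inclPairRing_rightPair]
  exact Ideal.mem_comap.1 (hQ (rightPair_mem_pairIdeal hγ))

theorem mem_pointsOver_of_pairIdeal_le (h𝔪 : 𝔪.IsMaximal)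
    {Q : Ideal (pairRing M (baseClosure Γ K L).toSubring)}
    (hQ : pairIdeal Γ M 𝔪 ≤ Q.comap (inclPairRing Γ K M))
    {t : M} {ℓ : Ideal (integralClosure Γ L)} (hℓ : ℓ.IsPrime)
    (hright : ∀ y : baseClosure Γ K L, Subalgebra.inclusion baseClosure_le y ∈ ℓ ↔
      rightPair M (baseClosure Γ K L).toSubring y ∈ Q)
    (hleft : ∀ x : baseClosure Γ K L,
      Subalgebra.inclusion baseClosure_le x ∈ Submonoid.inclusion hM t • ℓ ↔
        leftPair M (baseClosure Γ K L).toSubring x ∈ Q) :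
    ℓ ∈ pointsOver L 𝔪 ∧ Submonoid.inclusion hM t • ℓ ∈ pointsOver L 𝔪 :=
  ⟨mem_pointsOver h𝔪 hℓ fun _ hγ => (hright _).2 (rightPair_algebraMap_mem hQ hγ),
    mem_pointsOver h𝔪 (isPrime_smul _ hℓ) fun _ hγ =>
      (hleft _).2 (leftPair_algebraMap_mem hQ hγ)⟩

variable [Algebra k K] [IsScalarTower k K L]

theorem comap_vanishIdeal_sup_pairIdeal_eq_top [FiniteDimensional K L] [IsGalois K L]
    (hconj : IsConjClosed K M) (h𝔪 : 𝔪.IsMaximal)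
    (hfin : ∀ ℓ ∈ pointsOver L 𝔪, (stabilizerIn hM ℓ : Set M).Finite) {T E : Finset M}
    (hT : ∀ t ∈ T, t ∉ unitMovers hM 𝔪) (hE : ∀ t ∈ E, (t : L ≃ₐ[k] L)⁻¹ ∈ M) :
    (vanishIdeal (baseClosure Γ K L).toSubring (T : Set M) ⊔ vanishIdeal _ (E : Set M)).comap
      (inclPairRing Γ K M) ⊔ pairIdeal Γ M 𝔪 = ⊤ := by
  by_contra hne
  obtain ⟨P, hP, hle⟩ := Ideal.exists_le_maximal _ hne
  have hPprime := hP.isPrime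
  obtain ⟨Q, hQle, hQ, rfl⟩ : ∃ Q ≥ vanishIdeal (baseClosure Γ K L).toSubring (T : Set M) ⊔
      vanishIdeal _ (E : Set M), Q.IsPrime ∧ Q.comap (inclPairRing Γ K M) = P := by
    let _ := (inclPairRing Γ K M).toAlgebra
    have : Algebra.IsIntegral (pairRing M (algebraMap Γ L).range)
      (pairRing M (baseClosure Γ K L).toSubring) := ⟨isIntegral_inclPairRing⟩
    exact Ideal.exists_ideal_over_prime_of_isIntegral P _ (le_sup_left.trans hle)
  obtain ⟨t, ht, ℓ, hℓ, hright, hleft⟩ := exists_isPrime_of_forall_vanish_mem hM baseClosure_le Q T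
    (le_sup_left.trans hQle)
  obtain ⟨e, he, ℓ', hℓ', hright', hleft'⟩ := exists_isPrime_of_forall_vanish_mem hM
    baseClosure_le Q E (le_sup_right.trans hQle)
  have hover := mem_pointsOver_of_pairIdeal_le h𝔪 (le_sup_right.trans hle) hℓ hright hleft
  have hover' := mem_pointsOver_of_pairIdeal_le h𝔪 (le_sup_right.trans hle) hℓ' hright' hleft'
  refine hT t ht ⟨?_, ℓ, hover⟩
  exact inv_mem_of_underBase_eq hconj hM (hE e he) hℓ' hℓ (hfin ℓ' hover'.1)
    (Ideal.ext fun y => (hright y).trans (hright' y).symm)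
    (Ideal.ext fun x => (hleft x).trans (hleft' x).symm)

theorem exists_mem_pairIdeal_one_add_eq [FiniteDimensional K L] [IsGalois K L]
    (hconj : IsConjClosed K M) (h𝔪 : 𝔪.IsMaximal)
    (hfin : ∀ ℓ ∈ pointsOver L 𝔪, (stabilizerIn hM ℓ : Set M).Finite) {T E : Finset M}
    (hT : ∀ t ∈ T, t ∉ unitMovers hM 𝔪) (hE : ∀ t ∈ E, (t : L ≃ₐ[k] L)⁻¹ ∈ M) :
    ∃ b ∈ pairIdeal Γ M 𝔪, ∃ x ∈ vanishIdeal (baseClosure Γ K L).toSubring (T : Set M),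
      ∃ y ∈ vanishIdeal (baseClosure Γ K L).toSubring (E : Set M),
        inclPairRing Γ K M (1 + b) = x + y := by
  have htop := comap_vanishIdeal_sup_pairIdeal_eq_top hconj h𝔪 hfin hT hE
  obtain ⟨c, hc, b, hb, hcb⟩ := Submodule.mem_sup.1 ((Ideal.eq_top_iff_one _).1 htop)
  obtain ⟨x, hx, y, hy, hxy⟩ := Submodule.mem_sup.1 (Ideal.mem_comap.1 hc)
  refine ⟨-b, neg_mem hb, x, hx, y, hy, ?_⟩
  rw [hxy, ← hcb, add_neg_cancel_right]

theorem IsGaloisRing.exists_unitPart_scale_mem [FiniteDimensional K L] [IsGalois K L]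
    {hconj : IsConjClosed K M} {U : Subring (SkewMonoidAlgebra L M)}
    (hU : IsGaloisRing Γ hconj U) {d : L}
    (hd : ∀ x ∈ baseClosure Γ K L, d * x ∈ (algebraMap Γ L).range) (h𝔪 : 𝔪.IsMaximal)
    (hfin : ∀ ℓ ∈ pointsOver L 𝔪, (stabilizerIn hM ℓ : Set M).Finite)
    {u : SkewMonoidAlgebra L M} (hu : u ∈ U) :
    ∃ b ∈ pairIdeal Γ M 𝔪, unitPart (scale ((1 + b : pairRing M _) : M → L) u) ∈
      boundedBy U.toAddSubgroup (baseClosure Γ K L).toSubring d ⊓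
        supportedIn (unitMovers hM 𝔪) := by
  classical
  obtain ⟨b, hb, x, hx, y, hy, hxy⟩ := exists_mem_pairIdeal_one_add_eq hconj h𝔪 hfin
    (T := u.support.filter (· ∉ unitMovers hM 𝔪))
    (E := u.support.filter fun t : M => (t : L ≃ₐ[k] L)⁻¹ ∈ M)
    (fun t ht => (Finset.mem_filter.1 ht).2) fun t ht => (Finset.mem_filter.1 ht).2
  have hsupp : scale (x : M → L) u ∈ supportedIn (unitMovers hM 𝔪) :=
    scale_mem_supportedIn_of_forall fun t ht hne =>
      hx t (Finset.mem_filter.2 ⟨mem_support_iff.2 hne, ht⟩)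
  have hunit : unitPart (scale ((1 + b : pairRing M _) : M → L) u) = scale (x : M → L) u := by
    refine unitPart_eq_of_forall (fun t ht => ?_) fun t ht => hsupp t fun hmem => ht hmem.1
    by_cases hne : u.coeff t = 0
    · rw [coeff_scale, coeff_scale, hne, mul_zero, mul_zero]
    · have hyt : (y : M → L) t = 0 := hy t (Finset.mem_filter.2 ⟨mem_support_iff.2 hne, ht⟩)
      rw [coeff_scale, coeff_scale, ← coe_inclPairRing (K := K), hxy, Subring.coe_add,
        Pi.add_apply, hyt, add_zero]
  refine ⟨b, hb, ?_⟩
  rw [hunit]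
  exact AddSubgroup.mem_inf.2 ⟨scale_mem_boundedBy x.2 (hU.mem_boundedBy hd hu), hsupp⟩

end Approximation

section ScaleHom

variable {k Γ K L : Type*} [Field k] [CommRing Γ]
  [Field K] [Algebra k K] [Field L] [Algebra k L] [Algebra Γ L] [Algebra K L]
  [IsScalarTower k K L]
  {M : Submonoid (L ≃ₐ[k] L)} {hconj : IsConjClosed K M} {U : Subring (SkewMonoidAlgebra L M)}

/-- The orbit map of `u` for the action of `pairRing M (algebraMap Γ L).range` on a Galois ring. -/
noncomputable def IsGaloisRing.scaleHom (hU : IsGaloisRing Γ hconj U) (u : U) :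
    pairRing M (algebraMap Γ L).range →+ U :=
  AddMonoidHom.mk' (fun b => ⟨scale b u, hU.scale_mem b.2 u.2⟩) fun a b =>
    Subtype.ext (DFunLike.congr_fun (map_add scale (a : M → L) b) _)

theorem IsGaloisRing.scaleHom_one (hU : IsGaloisRing Γ hconj U) (u : U) : hU.scaleHom u 1 = u :=
  Subtype.ext (DFunLike.congr_fun (map_one scale) _)

theorem IsGaloisRing.scaleHom_mul (hU : IsGaloisRing Γ hconj U) (u : U)
    (a b : pairRing M (algebraMap Γ L).range) :
    hU.scaleHom u (a * b) = hU.scaleHom (hU.scaleHom u b) a :=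
  Subtype.ext (scale_mul_apply _ _ _)

theorem IsGaloisRing.scaleHom_leftPair (hU : IsGaloisRing Γ hconj U) (u : U) (γ : Γ) :
    hU.scaleHom u (leftPair M _ ((algebraMap Γ L).rangeRestrict γ)) = hU.incl γ * u :=
  Subtype.ext ((scale_pairFun _ _ _).trans (mul_one _))

theorem IsGaloisRing.scaleHom_rightPair (hU : IsGaloisRing Γ hconj U) (u : U) (γ : Γ) :
    hU.scaleHom u (rightPair M _ ((algebraMap Γ L).rangeRestrict γ)) = u * hU.incl γ :=
  Subtype.ext ((scale_pairFun _ _ _).trans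
    (congrArg (· * _) (one_mul (u : SkewMonoidAlgebra L M))))

end ScaleHom

section LeftIdealStability

variable {k Γ : Type*} [Field k] [IsAlgClosed k] [CommRing Γ] [Algebra k Γ]
  [Algebra.FiniteType k Γ] {𝔪 : Ideal Γ}

theorem exists_mem_span_sub_mem_leftIdealGen {A : Type*} [Ring A] [Algebra k A] {φ : Γ →ₐ[k] A}
    (h𝔪 : 𝔪.IsMaximal) {s : Set A} {x : A} (hx : x ∈ rightSpan (φ : Γ →+* A).range s) :
    ∃ e ∈ Submodule.span k s, x - e ∈ leftIdealGen (φ : Γ →+* A) 𝔪 := by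
  have hle : rightSpan (φ : Γ →+* A).range s ≤
      (Submodule.span k s).toAddSubgroup ⊔ (leftIdealGen (φ : Γ →+* A) 𝔪).toAddSubgroup := by
    refine (AddSubgroup.closure_le _).2 ?_
    rintro _ ⟨y, hy, _, ⟨γ, rfl⟩, rfl⟩
    obtain ⟨c, hc⟩ := exists_sub_algebraMap_mem k h𝔪 γ
    refine AddSubgroup.mem_sup.2 ⟨c • y, Submodule.smul_mem _ c (Submodule.subset_span hy),
      y * φ (γ - algebraMap k Γ c), Submodule.smul_mem _ y (Submodule.subset_span ⟨_, hc, rfl⟩), ?_⟩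
    rw [map_sub, φ.commutes, mul_sub, Algebra.smul_def, Algebra.commutes, add_sub_cancel]
    rfl
  obtain ⟨e, he, z, hz, rfl⟩ := AddSubgroup.mem_sup.1 (hle hx)
  exact ⟨e, he, by rwa [add_sub_cancel_left]⟩

variable {K L : Type*} [Field K] [Algebra k K] [Field L] [Algebra k L] [Algebra Γ L] [Algebra K L]
  [IsScalarTower k K L] [IsScalarTower k Γ L]
  {M : Submonoid (L ≃ₐ[k] L)} {hconj : IsConjClosed K M} {U : Subring (SkewMonoidAlgebra L M)}
  {I : Submodule U U}

theorem IsGaloisRing.scaleHom_mem (hU : IsGaloisRing Γ hconj U) (h𝔪 : 𝔪.IsMaximal)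
    (hI𝔪 : ∀ γ ∈ 𝔪, hU.incl γ ∈ I) {v : U} (hv : v ∈ I)
    (a : pairRing M (algebraMap Γ L).range) : hU.scaleHom v a ∈ I := by
  let _ := hU.algebra
  have hle : (pairRing M (algebraMap Γ L).range).toAddSubgroup ≤
      (I.toAddSubgroup.comap (hU.scaleHom v)).map
        (pairRing M (algebraMap Γ L).range).subtype.toAddMonoidHom := by
    refine pairRing_le ?_
    rintro _ ⟨x, rfl⟩ _ ⟨y, rfl⟩
    refine ⟨⟨_, pairFun_mem_pairRing ⟨x, rfl⟩ ⟨y, rfl⟩⟩, ?_, rfl⟩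
    have hxy : hU.scaleHom v ⟨_, pairFun_mem_pairRing ⟨x, rfl⟩ ⟨y, rfl⟩⟩ =
      hU.incl x * v * hU.incl y := Subtype.ext (scale_pairFun _ _ _)
    rw [SetLike.mem_coe, AddSubgroup.mem_comap, hxy]
    exact mul_map_mem (φ := hU.inclAlgHom) h𝔪 hI𝔪 (I.smul_mem (hU.incl x) hv) y
  obtain ⟨b, hb, hba⟩ := hle a.2
  exact Subtype.coe_injective hba ▸ hb

theorem IsGaloisRing.scaleHom_mem_of_mem_pairIdeal (hU : IsGaloisRing Γ hconj U)
    (h𝔪 : 𝔪.IsMaximal) (hI𝔪 : ∀ γ ∈ 𝔪, hU.incl γ ∈ I) {u : U} {c : k}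
    (hu : u - hU.incl (algebraMap k Γ c) ∈ I) {b : pairRing M (algebraMap Γ L).range}
    (hb : b ∈ pairIdeal Γ M 𝔪) : hU.scaleHom u b ∈ I := by
  let J : Ideal (pairRing M (algebraMap Γ L).range) :=
    { I.toAddSubgroup.comap (hU.scaleHom u) with
      smul_mem' := fun a b hb => by
        change hU.scaleHom u (a * b) ∈ I
        rw [hU.scaleHom_mul]
        exact hU.scaleHom_mem h𝔪 hI𝔪 hb a }
  have hleft (γ : Γ) (hγ : γ ∈ 𝔪) :
      hU.scaleHom u (leftPair M _ ((algebraMap Γ L).rangeRestrict γ)) ∈ I := by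
    have hsplit : hU.incl γ * u = hU.incl γ * (u - hU.incl (algebraMap k Γ c)) +
        hU.incl (algebraMap k Γ c) * hU.incl γ := by
      rw [hU.incl_algebraMap_mul_comm, mul_sub, sub_add_cancel]
    rw [hU.scaleHom_leftPair, hsplit]
    exact add_mem (I.smul_mem _ hu) (I.smul_mem _ (hI𝔪 γ hγ))
  have hright (γ : Γ) (hγ : γ ∈ 𝔪) :
      hU.scaleHom u (rightPair M _ ((algebraMap Γ L).rangeRestrict γ)) ∈ I :=
    hU.scaleHom_rightPair u γ ▸ I.smul_mem u (hI𝔪 γ hγ)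
  have hJ : pairIdeal Γ M 𝔪 ≤ J :=
    sup_le (Ideal.map_le_iff_le_comap.2 hleft) (Ideal.map_le_iff_le_comap.2 hright)
  exact hJ hb

end LeftIdealStability

section Fibers

variable {k Γ K L : Type*} [Field k] [IsAlgClosed k] [CommRing Γ] [Algebra k Γ]
  [Algebra.FiniteType k Γ]
  [Field K] [Algebra k K] [Algebra Γ K] [Field L] [Algebra k L] [Algebra Γ L] [Algebra K L]
  [IsScalarTower k K L] [IsScalarTower k Γ L] [IsScalarTower Γ K L]
  [FiniteDimensional K L] [IsGalois K L]
  {M : Submonoid (L ≃ₐ[k] L)} {hM : M ≤ pullbackMonoid Γ k L} {hconj : IsConjClosed K M}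
  {U : Subring (SkewMonoidAlgebra L M)} {𝔪 : Ideal Γ}

theorem IsGaloisRing.exists_unitPart_mem_approx (hU : IsGaloisRing Γ hconj U) {d : L}
    (hd : ∀ x ∈ baseClosure Γ K L, d * x ∈ (algebraMap Γ L).range) (h𝔪 : 𝔪.IsMaximal)
    (hfin : ∀ ℓ ∈ pointsOver L 𝔪, (stabilizerIn hM ℓ : Set M).Finite) (u : U) :
    ∃ u' : U, unitPart (u' : SkewMonoidAlgebra L M) ∈
      boundedBy U.toAddSubgroup (baseClosure Γ K L).toSubring d ⊓
        supportedIn (unitMovers hM 𝔪) ∧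
      ∀ I : Submodule U U, (∀ γ ∈ 𝔪, hU.incl γ ∈ I) → ∀ c : k,
        u - hU.incl (algebraMap k Γ c) ∈ I → u' - u ∈ I := by
  obtain ⟨b, hb, h⟩ := hU.exists_unitPart_scale_mem hd h𝔪 hfin u.2
  refine ⟨hU.scaleHom u (1 + b), h, fun I hI𝔪 c hc => ?_⟩
  rw [map_add, hU.scaleHom_one, add_sub_cancel_left]
  exact hU.scaleHom_mem_of_mem_pairIdeal h𝔪 hI𝔪 hc hb

theorem IsGaloisRing.exists_finite_rightSpan_approx
    [Module.Finite Γ (integralClosure Γ L)] [IsNoetherianRing Γ] [IsDomain Γ] [IsFractionRing Γ K]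
    (hU : IsGaloisRing Γ hconj U) (hR : IsRightOrder Γ hconj U) (hM : M ≤ pullbackMonoid Γ k L)
    (h𝔪 : 𝔪.IsMaximal) (hfin : ∀ ℓ ∈ pointsOver L 𝔪, (stabilizerIn hM ℓ : Set M).Finite) :
    ∃ s : Set U, s.Finite ∧ ∀ u : U, ∃ x ∈ rightSpan hU.incl.range s,
      ∀ I : Submodule U U, IsCoatom I → (∀ γ ∈ 𝔪, hU.incl γ ∈ I) → ∀ c : k,
        u - hU.incl (algebraMap k Γ c) ∈ I → u - x ∈ I := by
  have : FaithfulSMul Γ L := FaithfulSMul.trans Γ K L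
  have := finite_baseClosure Γ K L
  obtain ⟨d, hd0, hd⟩ := exists_conductor (Γ := Γ) (K := K) (L := L)
  obtain ⟨s, hs, hspan⟩ := hU.exists_finite_rightSpan
    (f := unitPart.comp U.subtype.toAddMonoidHom) (fun _ _ => unitPart_mul_single_one _ _)
    (fg_span_rightCoeff_boundedBy (C := (baseClosure Γ K L).toSubring)
      ((map_ne_zero_iff _ (FaithfulSMul.algebraMap_injective Γ L)).2 hd0)
      (hR.fg_span_rightCoeff hU (finite_unitMovers hfin)))
  refine ⟨s, hs, fun u => ?_⟩
  obtain ⟨u', hu', happrox⟩ := hU.exists_unitPart_mem_approx hd h𝔪 hfin u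
  obtain ⟨x, hx, hxu⟩ := hspan u' hu'
  refine ⟨x, hx, fun I hI hI𝔪 c hc => ?_⟩
  have hzero : unitPart ((u' - x : U) : SkewMonoidAlgebra L M) = 0 := by
    rw [AddSubgroupClass.coe_sub, map_sub, sub_eq_zero]
    exact hxu.symm
  have hux : u' - x ∈ I := hU.mem_of_forall_inv_notMem hM h𝔪 hfin hI hI𝔪 fun _ =>
    inv_notMem_of_unitPart_eq_zero hzero
  rw [← sub_sub_sub_cancel_left x u u']
  exact sub_mem hux (happrox I hI𝔪 c hc)

theorem IsGaloisRing.finite_fiber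
    [Module.Finite Γ (integralClosure Γ L)] [IsNoetherianRing Γ] [IsDomain Γ] [IsFractionRing Γ K]
    (hU : IsGaloisRing Γ hconj U) (hR : IsRightOrder Γ hconj U) (hM : M ≤ pullbackMonoid Γ k L)
    (h𝔪 : 𝔪.IsMaximal) (hfin : ∀ ℓ ∈ pointsOver L 𝔪, (stabilizerIn hM ℓ : Set M).Finite) :
    Finite (Fiber hU.incl 𝔪) := by
  let _ := hU.algebra
  obtain ⟨s, hs, happrox⟩ := hU.exists_finite_rightSpan_approx hR hM h𝔪 hfin
  have := Module.Finite.span_of_finite k hs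
  refine GaloisOrder.finite_fiber (Submodule.span k s) fun u => ?_
  obtain ⟨x, hx, hxu⟩ := happrox u
  obtain ⟨e, he, hxe⟩ := exists_mem_span_sub_mem_leftIdealGen (φ := hU.inclAlgHom) h𝔪 hx
  refine ⟨e, he, fun I hI hI𝔪 c hc => ?_⟩
  have hle : leftIdealGen hU.incl 𝔪 ≤ I := by
    refine Submodule.span_le.2 ?_
    rintro _ ⟨γ, hγ, rfl⟩
    exact hI𝔪 γ hγ
  rw [← sub_add_sub_cancel u x e]
  exact add_mem (hxu I hI hI𝔪 c hc) (hle hxe)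

end Fibers

section GelfandTsetlin

variable {k Γ K L : Type*} [Field k] [IsAlgClosed k] [CommRing Γ] [Algebra k Γ]
  [Algebra.FiniteType k Γ]
  [Field K] [Algebra k K] [Field L] [Algebra k L] [Algebra Γ L] [Algebra K L]
  [IsScalarTower k K L] [IsScalarTower k Γ L] [FiniteDimensional K L]
  {M : Submonoid (L ≃ₐ[k] L)} {hconj : IsConjClosed K M} {U : Subring (SkewMonoidAlgebra L M)}
  {𝔪 : Ideal Γ}

theorem IsGaloisRing.isGelfandTsetlin_quotient (hU : IsGaloisRing Γ hconj U)
    (hR : IsRightOrder Γ hconj U) (h𝔪 : 𝔪.IsMaximal) {I : Submodule U U}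
    (hI𝔪 : ∀ γ ∈ 𝔪, hU.incl γ ∈ I) : IsGelfandTsetlin hU.incl (U ⧸ I) := by
  let _ := hU.algebra
  have := Algebra.FiniteType.isNoetherianRing k Γ
  exact GaloisOrder.isGelfandTsetlin_quotient (φ := hU.inclAlgHom) h𝔪 I hI𝔪
    (hR.exists_finite_forall_incl_mul_mem_rightSpan hU)

end GelfandTsetlin

end GaloisOrder

theorem theoremA_general {k Γ K L : Type*}
    [Field k] [IsAlgClosed k] [CharZero k]
    [CommRing Γ] [IsDomain Γ] [Algebra k Γ] [Algebra.FiniteType k Γ]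
    [Field K] [Algebra k K] [Algebra Γ K] [IsScalarTower k Γ K] [IsFractionRing Γ K]
    [Field L] [Algebra k L] [Algebra Γ L] [Algebra K L]
    [IsScalarTower k K L] [IsScalarTower Γ K L]
    [FiniteDimensional K L] [IsGalois K L]
    {M : Submonoid (L ≃ₐ[k] L)} {hconj : GaloisOrder.IsConjClosed K M}
    {U : Subring (SkewMonoidAlgebra L M)} (hU : GaloisOrder.IsGaloisRing Γ hconj U)
    (hR : GaloisOrder.IsRightOrder Γ hconj U) {𝔪 : Ideal Γ} (h𝔪 : 𝔪.IsMaximal)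
    (hfin : ∀ ℓ : Ideal (integralClosure Γ L), ℓ.IsMaximal →
      ℓ.comap (algebraMap Γ (integralClosure Γ L)) = 𝔪 →
      (GaloisOrder.stabilizer M ℓ).Finite) :
    (Nonempty (GaloisOrder.Fiber hU.incl 𝔪) ∧
      GaloisOrder.leftIdealGen hU.incl 𝔪 ≠ ⊤ ∧
      ∃ I : Submodule U U, IsCoatom I ∧ (∀ γ ∈ 𝔪, hU.incl γ ∈ I) ∧
        IsSimpleModule U (U ⧸ I) ∧
        GaloisOrder.IsGelfandTsetlin hU.incl (U ⧸ I) ∧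
        GaloisOrder.weightSpace hU.incl (U ⧸ I) 𝔪 ≠ ⊥) ∧
    Finite (GaloisOrder.Fiber hU.incl 𝔪) := by
  have : IsScalarTower k Γ L := IsScalarTower.of_algebraMap_eq fun c => by
    rw [IsScalarTower.algebraMap_apply k K L, IsScalarTower.algebraMap_apply k Γ K,
      ← IsScalarTower.algebraMap_apply Γ K L]
  have : CharZero L := charZero_of_injective_algebraMap (algebraMap k L).injective
  have : IsNoetherianRing Γ := Algebra.FiniteType.isNoetherianRing k Γ
  have : Module.Finite Γ (integralClosure Γ L) := GaloisOrder.finite_integralClosure k Γ K L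
  have hM : M ≤ GaloisOrder.pullbackMonoid Γ k L := hR.le_pullbackMonoid hU
  have hstab : ∀ ℓ ∈ GaloisOrder.pointsOver L 𝔪, (GaloisOrder.stabilizerIn hM ℓ : Set M).Finite :=
    fun ℓ hℓ => GaloisOrder.finite_stabilizerIn hM
      (hfin ℓ (GaloisOrder.isMaximal_of_mem_pointsOver h𝔪 hℓ) hℓ.2)
  refine ⟨?_, hU.finite_fiber hR hM h𝔪 hstab⟩
  have hne := GaloisOrder.leftIdealGen_ne_top hU hR hM h𝔪 hstab
  obtain ⟨I, hI, hle⟩ := (eq_top_or_exists_le_coatom _).resolve_left hne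
  have hI𝔪 : ∀ γ ∈ 𝔪, hU.incl γ ∈ I := fun γ hγ => hle (Submodule.subset_span ⟨γ, hγ, rfl⟩)
  exact ⟨⟨Quotient.mk _ ⟨I, hI, hI𝔪⟩⟩, hne, I, hI, hI𝔪, isSimpleModule_iff_isCoatom.2 hI,
    hU.isGelfandTsetlin_quotient hR h𝔪 hI𝔪, GaloisOrder.weightSpace_quotient_ne_bot hI.1 hI𝔪⟩

theorem theoremA {k Γ K L : Type*}
    [Field k] [IsAlgClosed k] [CharZero k]
    [CommRing Γ] [IsDomain Γ] [Algebra k Γ] [Algebra.FiniteType k Γ]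
    [Field K] [Algebra k K] [Algebra Γ K] [IsScalarTower k Γ K] [IsFractionRing Γ K]
    [Field L] [Algebra k L] [Algebra Γ L] [Algebra K L]
    [IsScalarTower k K L] [IsScalarTower Γ K L]
    [FiniteDimensional K L] [IsGalois K L]
    (M : Submonoid (L ≃ₐ[k] L))
    (hM : GaloisOrder.IsConjClosed K M) (hsep : GaloisOrder.IsSeparating K M)
    (U : Subring (SkewMonoidAlgebra L M)) (hU : GaloisOrder.IsGaloisRing Γ hM U)
    (𝔪 : Ideal Γ) (h𝔪 : 𝔪.IsMaximal)
    (hfin : ∀ ℓ : Ideal (integralClosure Γ L), ℓ.IsMaximal →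
      ℓ.comap (algebraMap Γ (integralClosure Γ L)) = 𝔪 →
      (GaloisOrder.stabilizer M ℓ).Finite) :
    (GaloisOrder.IsRightOrder Γ hM U →
      Nonempty (GaloisOrder.Fiber hU.incl 𝔪) ∧
      GaloisOrder.leftIdealGen hU.incl 𝔪 ≠ ⊤ ∧
      ∃ I : Submodule U U, IsCoatom I ∧ (∀ γ ∈ 𝔪, hU.incl γ ∈ I) ∧
        IsSimpleModule U (U ⧸ I) ∧
        GaloisOrder.IsGelfandTsetlin hU.incl (U ⧸ I) ∧
        GaloisOrder.weightSpace hU.incl (U ⧸ I) 𝔪 ≠ ⊥) ∧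
    (GaloisOrder.IsRightOrder Γ hM U ∧ GaloisOrder.IsLeftOrder Γ hM U →
      Finite (GaloisOrder.Fiber hU.incl 𝔪)) :=
  ⟨fun hR => (theoremA_general hU hR h𝔪 hfin).1,
    fun h => (theoremA_general hU h.1 h𝔪 hfin).2⟩
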